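/- **Setting.** Let $(\mathcal S,\mathcal A,\mathsf P,r,\gamma)$ be a Markov decision process with finite action set, bounded reward $r(s,a,s')$ and discount factor $\gamma\in(0,1)$. Let $\pi$ be a target policy, $\pi_b$ a behavior policy, $\phi:\mathcal S\to\mathbb R^d$ a feature map and $\rho(s,a)=\pi(a|s)/\pi_b(a|s)$. Let $\mu$ be the stationary distribution of the state chain under $\pi_b$, and let $\mathbb E_\mu$ be the expectation for $s\sim\mu$, $a\sim\pi_b(\cdot|s)$, $s'\sim\mathsf P(\cdot|s,a)$. Put $$A=\mathbb E_\mu[\rho(s,a)\phi(s)(\gamma\phi(s')-\phi(s))^\top],\quad C=-\mathbb E_\mu[\phi(s)\phi(s)^\top],\quad b=\mathbb E_\mu[\rho(s,a)r(s,a,s')\phi(s)].$$ Assume that $A$ and $C$ are non-singular, that $\|\phi(s)\|_2\le1$ for all $s$ and $\sup_{s,a}\rho(s,a)<\infty$ (in particular $\pi(a|s)=0$ whenever $\pi_b(a|s)=0$), and that there are $m>0$, $\kappa\in(0,1)$ with $\sup_{s}d_{TV}(\mathbb P(s_t\in\cdot\,|s_0=s),\mu)\le m\kappa^t$ for all $t\ge0$,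 for the chain under $\pi_b$. Let $\theta^*=-A^{-1}b$ and $\psi(\theta)=-C^{-1}(b+A\theta)$, and let $\Pi_R$ be the projection onto the Euclidean ball of radius $R$ around $0$. On one sample path $s_0,a_0,s_1,a_1,\dots$ generated by $\pi_b$ (with any law of $s_0$), projected TDC with arbitrary initial point $(\theta_0,w_0)$ is $$\theta_{t+1}=\Pi_{R_\theta}\big(\theta_t+\alpha_t(A_t\theta_t+b_t+B_tw_t)\big),\qquad w_{t+1}=\Pi_{R_w}\big(w_t+\beta_t(A_t\theta_t+b_t+C_tw_t)\big),$$ where $A_t=\rho(s_t,a_t)\phi(s_t)(\gamma\phi(s_{t+1})-\phi(s_t))^\top$, $B_t=-\gamma\rho(s_t,a_t)\phi(s_{t+1})\phi(s_t)^\top$, $C_t=-\phi(s_t)\phi(s_t)^\top$, $b_t=\rho(s_t,a_t)r(s_t,a_t,s_{t+1})\phi(s_t)$. Assume $R_\theta\ge\|\theta^*\|_2$ and $R_w\ge2\|C^{-1}\|_2\|A\|_2R_\theta$. Let $z_t=w_t-\psi(\theta_t)$ be the tracking error, and let $\lambda_\theta,\lambda_w$ be any constants with $\lambda_{\max}(2A^\top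 C^{-1}A)\le\lambda_\theta<0$ and $\lambda_{\max}(2C)\le\lambda_w<0$. The stepsizes are $\alpha_t=c_\alpha/(1+t)^\sigma$ and $\beta_t=c_\beta/(1+t)^\nu$, with $0<c_\beta<1/|\lambda_w|$. For $\epsilon\in(0,\sigma-\nu]$ let $$h_t(\sigma,\nu)=\begin{cases}t^{-\nu},&\sigma>1.5\nu,\\ t^{-(2(\sigma-\nu)-\epsilon)},&\nu<\sigma\le1.5\nu.\end{cases}$$ **Theorem.** Let $\epsilon\in(0,\sigma-\nu]$ and $\epsilon'\in(0,0.5]$ be arbitrary. (i) If $0<\nu<\sigma<1$ and $0<c_\alpha<1/|\lambda_\theta|$, there is a constant $K$ such that for all $t\ge1$ $$\mathbb E\|\theta_t-\theta^*\|_2^2\le K\exp\Big(\tfrac{-|\lambda_\theta|c_\alpha}{1-\sigma}(t^{1-\sigma}-1)\Big)+K\,\frac{\log t}{t^\sigma}+\Big(K\Big(\frac{\log t}{t^\nu}+h_t(\sigma,\nu)\Big)\Big)^{1-\epsilon'},$$ $$\mathbb E\|z_t\|_2^2\le K\,\frac{\log t}{t^\nu}+K\,h_t(\sigma,\nu).$$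 (ii) If $0<\nu<\sigma=1$ and $c_\alpha=1/|\lambda_\theta|$, there is a constant $K$ such that for all $t\ge1$ $$\mathbb E\|\theta_t-\theta^*\|_2^2\le K\,\frac{(\log t)^2}{t}+\Big(K\Big(\frac{\log t}{t^\nu}+h_t(1,\nu)\Big)\Big)^{1-\epsilon'}.$$ (iii) If $\sigma=1.5\nu=1$ and $c_\alpha=1/|\lambda_\theta|$, there is a constant $K$ such that $\mathbb E\|\theta_t-\theta^*\|_2^2\le K\log t/t^{2/3}$ for all $t\ge2$. This choice of exponents is the best one for these bounds: over $0<\nu<\sigma\le1$, the decay exponent of $h_t(\sigma,\nu)$ as $\epsilon\to0$ (that is, $\nu$ if $\sigma>1.5\nu$ and $2(\sigma-\nu)$ otherwise) is at most $2/3$, with equality exactly for $\sigma=1.5\nu=1$. The constants $K$ may depend on the decision process, the policies, the features, $R_\theta,R_w,\lambda_\theta,\lambda_w$, the stepsize parameters and $\epsilon,\epsilon'$, but not on $t$, the sample path, the law of $s_0$ or $(\theta_0,w_0)$. -/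

import Mathlib

open MeasureTheory ProbabilityTheory Set Filter

noncomputable section

/-- Parameter space `ℝ^d` with the Euclidean norm. A `d × d` matrix is represented by the operator
`x ↦ M x` on this space, so that `‖M‖` is the spectral norm, `*` is the matrix product and the
adjoint is the transpose. -/
abbrev Param (d : ℕ) : Type := EuclideanSpace ℝ (Fin d)

/-- The total variation distance `sup_B |P(B) - Q(B)|` of two probability measures. -/
def tvDist {X : Type*} [MeasurableSpace X] (P Q : Measure X) : ℝ :=
  ⨆ B : {B : Set X // MeasurableSet B}, |P.real B.1 - Q.real B.1|

/-- Projection onto the closed Euclidean ball of radius `R` around `0`. -/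
def ballProj {d : ℕ} (R : ℝ) (x : Param d) : Param d :=
  if ‖x‖ ≤ R then x else (R / ‖x‖) • x

/-- `ballProj R x` is a point of the ball of radius `R` that is closest to `x`. -/
theorem ballProj_isArgmin {d : ℕ} {R : ℝ} (hR : 0 ≤ R) (x : Param d) :
    ‖ballProj R x‖ ≤ R ∧ ∀ y : Param d, ‖y‖ ≤ R → ‖x - ballProj R x‖ ≤ ‖x - y‖ := by
  unfold ballProj
  split_ifs with h
  · exact ⟨h, fun y _ => by simp⟩
  · have h' : R < ‖x‖ := lt_of_not_ge h
    have hx : 0 < ‖x‖ := lt_of_le_of_lt hR h'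
    refine ⟨?_, fun y hy => ?_⟩
    · rw [norm_smul, Real.norm_of_nonneg (div_nonneg hR hx.le), div_mul_cancel₀ _ hx.ne']
    · have e : x - (R / ‖x‖) • x = (1 - R / ‖x‖) • x := by rw [sub_smul, one_smul]
      have h1 : 0 ≤ 1 - R / ‖x‖ := by
        rw [sub_nonneg, div_le_one hx]; exact h'.le
      rw [e, norm_smul, Real.norm_of_nonneg h1, sub_mul, div_mul_cancel₀ _ hx.ne', one_mul]
      have := norm_sub_norm_le x y
      linarith

/-- An off-policy evaluation problem with linear features: a Markov decision process with state
space `S`, action set `A`, transition kernel `P`, bounded reward `r` and discount factor `γ`, the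
target policy `π`, the behavior policy `πb`, a feature map `φ`, and a stationary distribution `μ` of
the state chain under the behavior policy. -/
structure OffPolicyProblem (S A : Type*) [MeasurableSpace S] [MeasurableSpace A] (d : ℕ) where
  P : Kernel (S × A) S
  markov_P : IsMarkovKernel P
  r : S × A × S → ℝ
  measurable_r : Measurable r
  bounded_r : ∃ rmax : ℝ, ∀ o, |r o| ≤ rmax
  γ : ℝ
  γ_pos : 0 < γ
  γ_lt_one : γ < 1
  π : Kernel S A
  markov_π : IsMarkovKernel π
  πb : Kernel S A
  markov_πb : IsMarkovKernel πb
  φ : S → Param d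
  measurable_φ : Measurable φ
  μ : Measure S
  prob_μ : IsProbabilityMeasure μ
  stationary_μ : Kernel.Invariant (Kernel.snd (πb ⊗ₖ P)) μ

namespace OffPolicyProblem

variable {S A : Type*} [MeasurableSpace S] [MeasurableSpace A] {d : ℕ}

/-- Law of (action, next state) given the current state, under the behavior policy. -/
def actStep (M : OffPolicyProblem S A d) : Kernel S (A × S) := M.πb ⊗ₖ M.P

/-- Transition kernel of the state chain under the behavior policy. -/
def stateStep (M : OffPolicyProblem S A d) : Kernel S S := Kernel.snd (M.πb ⊗ₖ M.P)

/-- Law of the observation `(s, a, s')` with `s ∼ μ`, `a ∼ πb(·|s)`, `s' ∼ P(·|s,a)`. -/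
def obsLaw (M : OffPolicyProblem S A d) : Measure (S × A × S) := M.μ ⊗ₘ (M.πb ⊗ₖ M.P)

/-- Importance weight `π(a|s) / πb(a|s)`. -/
def ρ (M : OffPolicyProblem S A d) (s : S) (a : A) : ℝ := (M.π s).real {a} / (M.πb s).real {a}

/-! Matrices and vector built from one observation `o = (s, a, s')`;
`rankOne ℝ x y` is the matrix `x yᵀ`. -/

/-- `ρ(s,a) φ(s) (γ φ(s') - φ(s))ᵀ` -/
def matA (M : OffPolicyProblem S A d) (o : S × A × S) : Param d →L[ℝ] Param d :=
  M.ρ o.1 o.2.1 • InnerProductSpace.rankOne ℝ (M.φ o.1) (M.γ • M.φ o.2.2 - M.φ o.1)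

/-- `-γ ρ(s,a) φ(s') φ(s)ᵀ` -/
def matB (M : OffPolicyProblem S A d) (o : S × A × S) : Param d →L[ℝ] Param d :=
  -((M.γ * M.ρ o.1 o.2.1) • InnerProductSpace.rankOne ℝ (M.φ o.2.2) (M.φ o.1))

/-- `-φ(s) φ(s)ᵀ` -/
def matC (M : OffPolicyProblem S A d) (o : S × A × S) : Param d →L[ℝ] Param d :=
  -InnerProductSpace.rankOne ℝ (M.φ o.1) (M.φ o.1)

/-- `ρ(s,a) r(s,a,s') φ(s)` -/
def vecb (M : OffPolicyProblem S A d) (o : S × A × S) : Param d :=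
  (M.ρ o.1 o.2.1 * M.r o) • M.φ o.1

/-- `A = E[ρ φ(s) (γ φ(s') - φ(s))ᵀ]` -/
def meanA (M : OffPolicyProblem S A d) : Param d →L[ℝ] Param d := ∫ o, M.matA o ∂M.obsLaw

/-- `C = -E[φ(s) φ(s)ᵀ]` -/
def meanC (M : OffPolicyProblem S A d) : Param d →L[ℝ] Param d := ∫ o, M.matC o ∂M.obsLaw

/-- `b = E[ρ r φ(s)]` -/
def meanb (M : OffPolicyProblem S A d) : Param d := ∫ o, M.vecb o ∂M.obsLaw

/-- `C⁻¹` -/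
def invC (M : OffPolicyProblem S A d) : Param d →L[ℝ] Param d := Ring.inverse M.meanC

/-- `θ* = -A⁻¹ b` -/
def θstar (M : OffPolicyProblem S A d) : Param d := -(Ring.inverse M.meanA) M.meanb

/-- `ψ(θ) = -C⁻¹ (b + A θ)` -/
def ψ (M : OffPolicyProblem S A d) (θ : Param d) : Param d := -M.invC (M.meanb + M.meanA θ)

/-- Problem solvability: `A` and `C` are non-singular. -/
def Solvable (M : OffPolicyProblem S A d) : Prop := IsUnit M.meanA ∧ IsUnit M.meanC

/-- `‖φ(s)‖ ≤ 1` for all `s`, and the importance weights are bounded. Multiplying out the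
denominator also says that `πb(a|s) = 0` forces `π(a|s) = 0` (otherwise the weight is infinite). -/
def BoundedFeatures (M : OffPolicyProblem S A d) : Prop :=
  (∀ s, ‖M.φ s‖ ≤ 1) ∧
    ∃ ρmax : ℝ, ∀ s a, (M.π s).real {a} ≤ ρmax * (M.πb s).real {a}

/-- `sup_s d_TV(P(s_t ∈ · | s_0 = s), μ) ≤ m κ^t` for all `t`, for some `m > 0`, `κ ∈ (0,1)`. -/
def GeometricallyErgodic (M : OffPolicyProblem S A d) : Prop :=
  ∃ m κ : ℝ, 0 < m ∧ 0 < κ ∧ κ < 1 ∧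
    ∀ (t : ℕ) (s : S), tvDist ((M.stateStep ^ t) s) M.μ ≤ m * κ ^ t

/-- `(s_t, a_t)` is a trajectory of the decision process under the behavior policy, with respect
to the filtration `ℱ`: given `ℱ_t`, one has `a_t ∼ πb(·|s_t)` and `s_{t+1} ∼ P(·|s_t,a_t)`.
The law of `s_0` is arbitrary. -/
structure IsSamplePath (M : OffPolicyProblem S A d) {Ω : Type*} [mΩ : MeasurableSpace Ω]
    (Pr : Measure Ω) (ℱ : Filtration ℕ mΩ) (s : ℕ → Ω → S) (a : ℕ → Ω → A) : Prop where
  measurable_state : ∀ t, Measurable[ℱ t] (s t)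
  measurable_action : ∀ t, Measurable[ℱ (t + 1)] (a t)
  cond_law : ∀ (t : ℕ) (B : Set (A × S)), MeasurableSet B →
    Pr[((fun ω => (a t ω, s (t + 1) ω)) ⁻¹' B).indicator (fun _ => (1 : ℝ)) | ℱ t]
      =ᵐ[Pr] fun ω => (M.actStep (s t ω)).real B

/-- The iterates `(θ_t, w_t)` of projected TDC along the observations `o_t = (s_t, a_t, s_{t+1})`,
with projection radii `Rθ`, `Rw`, stepsizes `α`, `β` and initial point `(θ0, w0)`. -/
def tdc (M : OffPolicyProblem S A d) (Rθ Rw : ℝ) (α β : ℕ → ℝ) (θ0 w0 : Param d)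
    (o : ℕ → S × A × S) : ℕ → Param d × Param d
  | 0 => (θ0, w0)
  | t + 1 =>
    let θ := (M.tdc Rθ Rw α β θ0 w0 o t).1
    let w := (M.tdc Rθ Rw α β θ0 w0 o t).2
    (ballProj Rθ (θ + α t • (M.matA (o t) θ + M.vecb (o t) + M.matB (o t) w)),
      ballProj Rw (w + β t • (M.matA (o t) θ + M.vecb (o t) + M.matC (o t) w)))

/-- The squared training error `‖θ_t - θ*‖²` on the outcome `ω`. -/
def trainErr (M : OffPolicyProblem S A d) {Ω : Type*} (Rθ Rw : ℝ) (α β : ℕ → ℝ) (θ0 w0 : Param d)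
    (s : ℕ → Ω → S) (a : ℕ → Ω → A) (t : ℕ) (ω : Ω) : ℝ :=
  ‖(M.tdc Rθ Rw α β θ0 w0 (fun i => (s i ω, a i ω, s (i + 1) ω)) t).1 - M.θstar‖ ^ 2

/-- The squared tracking error `‖z_t‖²`, `z_t = w_t - ψ(θ_t)`, on the outcome `ω`. -/
def trackErr (M : OffPolicyProblem S A d) {Ω : Type*} (Rθ Rw : ℝ) (α β : ℕ → ℝ) (θ0 w0 : Param d)
    (s : ℕ → Ω → S) (a : ℕ → Ω → A) (t : ℕ) (ω : Ω) : ℝ :=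
  ‖(M.tdc Rθ Rw α β θ0 w0 (fun i => (s i ω, a i ω, s (i + 1) ω)) t).2
    - M.ψ (M.tdc Rθ Rw α β θ0 w0 (fun i => (s i ω, a i ω, s (i + 1) ω)) t).1‖ ^ 2

/-- `lθ < 0` is an upper bound of all eigenvalues of `2 Aᵀ C⁻¹ A`. -/
def SlowRate (M : OffPolicyProblem S A d) (lθ : ℝ) : Prop :=
  lθ < 0 ∧ ∀ x ∈ spectrum ℝ
    ((2 : ℝ) • (ContinuousLinearMap.adjoint M.meanA * M.invC * M.meanA)), x ≤ lθ

/-- `lw < 0` is an upper bound of all eigenvalues of `2 C`. -/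
def FastRate (M : OffPolicyProblem S A d) (lw : ℝ) : Prop :=
  lw < 0 ∧ ∀ x ∈ spectrum ℝ ((2 : ℝ) • M.meanC), x ≤ lw

end OffPolicyProblem

/-- The diminishing stepsize `c / (1 + t)^p`. -/
def polyStep (c p : ℝ) (t : ℕ) : ℝ := c / (1 + (t : ℝ)) ^ p

/-- Decay exponent of `h(σ, ν)`: `ν` if `σ > 1.5 ν`, and `2(σ - ν) - ε` if `σ ≤ 1.5 ν`. -/
def rateExp (σ ν ε : ℝ) : ℝ := if 3 / 2 * ν < σ then ν else 2 * (σ - ν) - ε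

/-- `h(σ, ν)` at time `t`. -/
def hRate (σ ν ε : ℝ) (t : ℕ) : ℝ := 1 / (t : ℝ) ^ rateExp σ ν ε

end

/-! Both errors are shown to decay in mean square like `t ^ (-δ)` with `δ = min ν (2 * (σ - ν))`.
This bound has no logarithm and implies all the stated rates.

Mean fields. Averaged over the stationary law, the fast update moves `z = w - ψ θ` along `C z`.
Importance weights average to one given the state, so `B = C - Aᵀ` (`meanB_eq`), and the slow update
moves `θ - θ*` along `Aᵀ C⁻¹ A (θ - θ*) + B z`. Both operators are symmetric, so the eigenvalue
bounds give contraction. The projections do not hurt, since `θ*` and every `ψ θ` with `‖θ‖ ≤ Rθ` lie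
in the respective balls.

Markovian noise. The deviation of an update from its mean field is a bounded functional
`dirFunctional` of the current iterates, applied to a centred observable. If `V` solves the Poisson
equation of the conditional mean of the observable, the expected noise at time `t` is `E Y_t(V(s_t))
- E Y_t(V(s_{t+1}))`. This telescopes up to the increment of `Y`, which is of the order of the fast
stepsize (`exists_noise_bound`). No mixing-time argument is needed, and no logarithm appears.

Recursions. The tracking error contracts at rate `β`. Its forcing is `β ^ 2` from noise and `α ^ 2 /
β` from the moving target `ψ θ_t`; relative to `β` these have exponents `ν` and `2 * (σ - ν)`. The
training error contracts at rate `α`, with forcing `α * β` from noise and `α * E‖z‖ ^ 2` from the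
coupling, so it inherits the same exponent. `chung_telescoping` converts both recursions into rates.
-/

noncomputable section

/-! ### Stepsizes and Chung-type recursions -/

theorem polyStep_pos {c p : ℝ} (hc : 0 < c) (t : ℕ) : 0 < polyStep c p t :=
  div_pos hc (Real.rpow_pos_of_pos (by positivity) _)

theorem polyStep_le {c p : ℝ} (hc : 0 < c) (hp : 0 ≤ p) (t : ℕ) : polyStep c p t ≤ c :=
  div_le_self hc.le (Real.one_le_rpow (by simp) hp)

theorem polyStep_le_mul_rpow {c p δ : ℝ} (hc : 0 < c) (hδ : 0 ≤ δ) (hδp : δ ≤ p) {t : ℕ}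
    (ht : 1 ≤ t) : polyStep c p t ≤ c * (t : ℝ) ^ (-δ) := by
  have h1 : (1 : ℝ) ≤ t := by exact_mod_cast ht
  rw [polyStep, div_eq_mul_inv, Real.rpow_neg (by linarith)]
  gcongr
  calc (t : ℝ) ^ δ ≤ (1 + t : ℝ) ^ δ := by gcongr; linarith
    _ ≤ (1 + t : ℝ) ^ p := Real.rpow_le_rpow_of_exponent_le (by linarith) hδp

theorem polyStep_succ_le {c p : ℝ} (hc : 0 < c) (hp : 0 ≤ p) (t : ℕ) :
    polyStep c p (t + 1) ≤ polyStep c p t := by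
  unfold polyStep
  gcongr
  simp

/-- For `p ≤ 1` the ratio of consecutive steps is `((1 + t) / (2 + t)) ^ p ≥ (1 + t) / (2 + t)`, so
the relative decrease is at most `1 / (2 + t)`. This is the cost of summation by parts in
`chung_telescoping`. -/
theorem polyStep_sub_succ_le {c p : ℝ} (hc : 0 < c) (hp1 : p ≤ 1) {t : ℕ}
    (ht : 1 ≤ t) : polyStep c p t - polyStep c p (t + 1) ≤ polyStep c p t * (t : ℝ) ^ (-1 : ℝ) := by
  have h1 : (1 : ℝ) ≤ t := by exact_mod_cast ht
  have hA : (0 : ℝ) < (1 + t : ℝ) ^ p := Real.rpow_pos_of_pos (by linarith) _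
  have hB : (0 : ℝ) < (1 + (t + 1) : ℝ) ^ p := Real.rpow_pos_of_pos (by linarith) _
  have key : (1 + t : ℝ) / (1 + (t + 1)) ≤ (1 + t : ℝ) ^ p / (1 + (t + 1)) ^ p := by
    rw [← Real.div_rpow (by linarith) (by linarith)]
    apply Real.self_le_rpow_of_le_one (by positivity) _ hp1
    rw [div_le_one (by linarith)]; linarith
  have e : polyStep c p (t + 1)
      = polyStep c p t * ((1 + t : ℝ) ^ p / (1 + (t + 1)) ^ p) := by
    unfold polyStep; push_cast; field_simp
  have hs := polyStep_pos (p := p) hc t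
  have h2 : 1 - (1 + t : ℝ) / (1 + (t + 1)) ≤ (t : ℝ) ^ (-1 : ℝ) := by
    rw [Real.rpow_neg_one]
    have : 1 - (1 + t : ℝ) / (1 + (t + 1)) = (1 + (t + 1) : ℝ)⁻¹ := by field_simp; ring
    rw [this]; gcongr; linarith
  rw [e]
  nlinarith [mul_le_mul_of_nonneg_left (h2.trans' (sub_le_sub_left key 1)) hs.le]

/-- The power `t ^ (-δ)` decays more slowly than a recursion contracting by `1 - q c / (1 + t) ^ p`
when `p < 1` or `δ < q c`. -/
theorem eventually_rpow_mul_one_sub_le {c p q δ : ℝ} (hc : 0 < c) (hp : 0 ≤ p) (hq : 0 < q)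
    (hδ : 0 ≤ δ) (hpq : p < 1 ∨ p = 1 ∧ δ < q * c) :
    ∀ᶠ t : ℕ in atTop,
      (t : ℝ) ^ (-δ) * (1 - q * polyStep c p t) ≤ ((t + 1 : ℕ) : ℝ) ^ (-δ) := by
  -- This is `δ / t ≤ q * polyStep c p t` with denominators cleared. For `p < 1` the step eventually
  -- dominates `1 / t`; for `p = 1` the constants have to be compared.
  have main : ∀ᶠ t : ℕ in atTop, δ * (1 + t : ℝ) ^ p ≤ q * c * t := by
    rcases hpq with h | ⟨rfl, h⟩
    · have h1 : Tendsto (fun t : ℕ => ((1 : ℝ) + t) ^ (1 - p)) atTop atTop :=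
        (tendsto_rpow_atTop (by linarith)).comp
          (tendsto_atTop_add_const_left _ _ tendsto_natCast_atTop_atTop)
      filter_upwards [h1.eventually_ge_atTop (2 * δ / (q * c)), eventually_ge_atTop 1] with t ht ht1
      have h1 : (1 : ℝ) ≤ t := by exact_mod_cast ht1
      rw [Real.rpow_sub (by positivity), Real.rpow_one,
        div_le_div_iff₀ (by positivity) (by positivity)] at ht
      nlinarith [mul_pos hq hc]
    · filter_upwards [tendsto_natCast_atTop_atTop.eventually_ge_atTop (δ / (q * c - δ))] with t ht
      rw [div_le_iff₀ (by linarith)] at ht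
      rw [Real.rpow_one]; linarith
  filter_upwards [main, eventually_ge_atTop 1] with t ht ht1
  have h1 : (1 : ℝ) ≤ t := by exact_mod_cast ht1
  have h0 : (0 : ℝ) < t := by linarith
  have hA : (0 : ℝ) < (1 + t : ℝ) ^ p := Real.rpow_pos_of_pos (by linarith) _
  have h2 : δ / t ≤ q * polyStep c p t := by
    rw [polyStep, ← mul_div_assoc, div_le_div_iff₀ h0 hA]; exact ht
  have h3 : 1 - δ / t ≤ (1 + 1 / (t : ℝ)) ^ (-δ) := by
    rw [Real.rpow_def_of_pos (by positivity)]
    have := Real.add_one_le_exp (Real.log (1 + 1 / (t : ℝ)) * -δ)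
    have h4 := Real.log_le_sub_one_of_pos (x := 1 + 1 / (t : ℝ)) (by positivity)
    have : Real.log (1 + 1 / (t : ℝ)) * δ ≤ 1 / (t : ℝ) * δ := by gcongr; linarith
    have e : 1 / (t : ℝ) * δ = δ / t := by ring
    linarith
  have e : ((t + 1 : ℕ) : ℝ) ^ (-δ) = (t : ℝ) ^ (-δ) * (1 + 1 / (t : ℝ)) ^ (-δ) := by
    rw [← Real.mul_rpow h0.le (by positivity)]; congr 1; push_cast; field_simp
  rw [e]
  gcongr
  linarith

/-- Chung's lemma for stepsizes `c / (1 + t) ^ p`. -/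
theorem chung {c p b δ C U : ℝ} (hc : 0 < c) (hp : 0 < p) (hb : 0 < b) (hC : 0 ≤ C) (hU : 0 ≤ U)
    (hδ : 0 ≤ δ) (hpb : p < 1 ∨ p = 1 ∧ δ < b * c) :
    ∃ K, 0 ≤ K ∧ ∀ v : ℕ → ℝ, (∀ t, 1 ≤ t → v t ≤ U) →
      (∀ t, 1 ≤ t → v (t + 1) ≤ (1 - b * polyStep c p t) * v t
        + C * polyStep c p t * (t : ℝ) ^ (-δ)) →
      ∀ t, 1 ≤ t → v t ≤ K * (t : ℝ) ^ (-δ) := by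
  -- The contraction `b` is split: `q` pays for the decrease of `t ^ (-δ)` and `b - q` absorbs the
  -- forcing `C`. For `p = 1`, `q` is the midpoint of `δ / c` and `b`.
  obtain ⟨q, hq0, hqb, hq⟩ : ∃ q, 0 < q ∧ q < b ∧ (p < 1 ∨ p = 1 ∧ δ < q * c) := by
    rcases hpb with h | ⟨h, h'⟩
    · exact ⟨b / 2, by linarith, by linarith, Or.inl h⟩
    · refine ⟨(δ / c + b) / 2, by positivity, ?_, Or.inr ⟨h, ?_⟩⟩
      · have : δ / c < b := by rw [div_lt_iff₀ hc]; exact h'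
        linarith
      · have : (δ / c + b) / 2 * c = (δ + b * c) / 2 := by field_simp
        rw [this]; linarith
  have hsmall : ∀ᶠ t : ℕ in atTop, b * polyStep c p t ≤ 1 := by
    have h1 : Tendsto (fun t : ℕ => ((1 : ℝ) + t) ^ p) atTop atTop :=
      (tendsto_rpow_atTop hp).comp
        (tendsto_atTop_add_const_left _ _ tendsto_natCast_atTop_atTop)
    filter_upwards [h1.eventually_ge_atTop (b * c)] with t ht
    rw [polyStep, ← mul_div_assoc]
    exact div_le_one_of_le₀ ht (by positivity)
  obtain ⟨t0, ht0⟩ := eventually_atTop.1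
    (hsmall.and (eventually_rpow_mul_one_sub_le hc hp.le hq0 hδ hq))
  have hbq : 0 < b - q := by linarith
  -- The first summand gives `C ≤ (b - q) * K`, which closes the induction; the second covers all `t
  -- ≤ t0 + 1` through the a priori bound `U`. Neither depends on the sequence `v`.
  set K := C / (b - q) + U * ((t0 + 1 : ℕ) : ℝ) ^ δ with hK
  have hK0 : 0 ≤ K := by positivity
  refine ⟨K, hK0, fun v hvU hrec t ht => ?_⟩
  have start : ∀ t, 1 ≤ t → t ≤ t0 + 1 → v t ≤ K * (t : ℝ) ^ (-δ) := by
    intro t ht htt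
    have h0 : (0 : ℝ) < t := by exact_mod_cast ht
    have h2 : (t : ℝ) ^ δ ≤ ((t0 + 1 : ℕ) : ℝ) ^ δ := by gcongr
    have h3 : (0 : ℝ) < (t : ℝ) ^ δ := Real.rpow_pos_of_pos h0 _
    rw [Real.rpow_neg h0.le, ← div_eq_mul_inv, le_div_iff₀ h3]
    calc v t * (t : ℝ) ^ δ ≤ U * ((t0 + 1 : ℕ) : ℝ) ^ δ :=
          mul_le_mul (hvU t ht) h2 h3.le hU
      _ ≤ K := by rw [hK]; linarith [div_nonneg hC hbq.le]
  rcases le_total t (t0 + 1) with h | h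
  · exact start t ht h
  · induction t, h using Nat.le_induction with
    | base => exact start _ ht le_rfl
    | succ t h ih =>
      have ht1 : 1 ≤ t := by omega
      obtain ⟨h1, h2⟩ := ht0 t (by omega)
      have hs := polyStep_pos (p := p) hc t
      have hx : 0 < (t : ℝ) ^ (-δ) := Real.rpow_pos_of_pos (by exact_mod_cast ht1) _
      have hCK : C ≤ (b - q) * K := by
        have : C / (b - q) ≤ K := le_add_of_nonneg_right (by positivity)
        rw [div_le_iff₀ hbq] at this; linarith
      have e1 := mul_le_mul_of_nonneg_left (ih ht1) (sub_nonneg.2 h1)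
      have e2 := mul_le_mul_of_nonneg_right hCK (mul_pos hs hx).le
      have e3 := mul_le_mul_of_nonneg_left h2 hK0
      have := hrec t ht1
      nlinarith

/-- Chung's lemma with an additional telescoping perturbation. -/
theorem chung_telescoping {c p b δ C U : ℝ} (hc : 0 < c) (hp : 0 < p) (hp1 : p ≤ 1) (hb : 0 < b)
    (hC : 0 ≤ C) (hU : 0 ≤ U) (hδ : 0 ≤ δ) (hδp : δ ≤ p) (hpb : p < 1 ∨ p = 1 ∧ δ < b * c) :
    ∃ K, 0 ≤ K ∧ ∀ u D : ℕ → ℝ, (∀ t, 1 ≤ t → u t ≤ U) → (∀ t, 1 ≤ t → |D t| ≤ U) →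
      (∀ t, 1 ≤ t → u (t + 1) ≤ (1 - b * polyStep c p t) * u t
        + polyStep c p t * (D t - D (t + 1)) + C * polyStep c p t * (t : ℝ) ^ (-δ)) →
      ∀ t, 1 ≤ t → u t ≤ K * (t : ℝ) ^ (-δ) := by
  obtain ⟨K, hK0, hK⟩ := chung (C := b * c * U + U + C) (U := U + c * U) hc hp hb (by positivity)
    (by positivity) hδ hpb
  refine ⟨K + c * U, by positivity, fun u D hu hD hrec t ht => ?_⟩
  have hγ : ∀ t, 1 ≤ t → polyStep c p t ≤ c * (t : ℝ) ^ (-δ) :=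
    fun t ht => polyStep_le_mul_rpow hc hδ hδp ht
  have hx : ∀ t : ℕ, 0 ≤ (t : ℝ) ^ (-δ) := fun t => Real.rpow_nonneg (Nat.cast_nonneg t) _
  have hDs : ∀ t s, 1 ≤ t → polyStep c p s * D t ≤ polyStep c p s * U := fun t s ht =>
    mul_le_mul_of_nonneg_left (abs_le.1 (hD t ht)).2 (polyStep_pos hc s).le
  -- Summation by parts: `u t + γ_t * D t`, with `γ_t` the step, satisfies a plain Chung recursion.
  -- The leftovers `b * γ_t ^ 2 * D t` and `(γ_t - γ_{t+1}) * D (t + 1)` are both of order `γ_t * t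
  -- ^ (-δ)`, because `δ ≤ p ≤ 1`.
  have := hK (fun t => u t + polyStep c p t * D t) ?_ ?_ t ht
  · have h1 := mul_le_mul_of_nonneg_left (neg_le.1 (abs_le.1 (hD t ht)).1)
      (polyStep_pos (p := p) hc t).le
    have h2 := mul_le_mul_of_nonneg_right (hγ t ht) hU
    nlinarith
  · intro t ht
    have := mul_le_mul_of_nonneg_right (polyStep_le hc hp.le t) hU
    linarith [hu t ht, hDs t t ht]
  · intro t ht
    have hs := polyStep_pos (p := p) hc t
    have h1 := hrec t ht
    have h2 : polyStep c p t - polyStep c p (t + 1) ≤ polyStep c p t * (t : ℝ) ^ (-δ) := by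
      refine (polyStep_sub_succ_le hc hp1 ht).trans ?_
      gcongr
      · exact_mod_cast ht
      · linarith
    have h3 : (polyStep c p t - polyStep c p (t + 1)) * -D (t + 1)
        ≤ polyStep c p t * (t : ℝ) ^ (-δ) * U := by
      have h4 := sub_nonneg.2 (polyStep_succ_le (p := p) hc hp.le t)
      calc _ ≤ (polyStep c p t - polyStep c p (t + 1)) * U := by
            apply mul_le_mul_of_nonneg_left _ h4
            linarith [(abs_le.1 (hD (t + 1) (by omega))).1]
        _ ≤ _ := mul_le_mul_of_nonneg_right h2 hU
    have h5 : b * polyStep c p t * (polyStep c p t * D t)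
        ≤ b * polyStep c p t * (c * (t : ℝ) ^ (-δ) * U) := by
      apply mul_le_mul_of_nonneg_left _ (by positivity)
      exact (hDs t t ht).trans (mul_le_mul_of_nonneg_right (hγ t ht) hU)
    nlinarith

/-! ### Total variation and the Poisson equation -/

section TotalVariation

variable {X E : Type*} [MeasurableSpace X] [NormedAddCommGroup E] [NormedSpace ℝ E]
  {P Q : Measure X} [IsProbabilityMeasure P] [IsProbabilityMeasure Q]

theorem abs_measureReal_sub_le_tvDist {B : Set X} (hB : MeasurableSet B) :
    |P.real B - Q.real B| ≤ tvDist P Q := by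
  refine le_ciSup (f := fun B : {B : Set X // MeasurableSet B} => |P.real B.1 - Q.real B.1|)
    ⟨1, ?_⟩ ⟨B, hB⟩
  rintro _ ⟨B, rfl⟩
  have h1 := measureReal_le_one (μ := P) (s := B.1)
  have h2 := measureReal_le_one (μ := Q) (s := B.1)
  have h3 := measureReal_nonneg (μ := P) (s := B.1)
  have h4 := measureReal_nonneg (μ := Q) (s := B.1)
  exact abs_le.2 ⟨by linarith, by linarith⟩

/-- Layer-cake formula: both integrals are integrals over `(0, B]` of the measures of superlevel
sets, which differ by at most the total variation distance at each level. -/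
theorem abs_integral_sub_integral_le_of_nonneg {g : X → ℝ} {B : ℝ} (hg : StronglyMeasurable g)
    (h0 : ∀ x, 0 ≤ g x) (hB : ∀ x, g x ≤ B) :
    |∫ x, g x ∂P - ∫ x, g x ∂Q| ≤ B * tvDist P Q := by
  have hB0 : 0 ≤ B := by
    obtain ⟨x⟩ := P.nonempty_of_neZero
    exact (h0 x).trans (hB x)
  have hint : ∀ (η : Measure X) [IsProbabilityMeasure η], Integrable g η := fun η _ =>
    Integrable.of_bound hg.aestronglyMeasurable B
      (ae_of_all _ fun x => by rw [Real.norm_of_nonneg (h0 x)]; exact hB x)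
  have hlc : ∀ (η : Measure X) [IsProbabilityMeasure η],
      ∫ x, g x ∂η = ∫ t in Ioc 0 B, η.real {x | t ≤ g x} := fun η _ =>
    (hint η).integral_eq_integral_Ioc_meas_le (ae_of_all _ h0) (ae_of_all _ hB)
  have hI : ∀ (η : Measure X) [IsProbabilityMeasure η],
      IntegrableOn (fun t => η.real {x | t ≤ g x}) (Ioc 0 B) := by
    intro η _
    have hanti : Antitone fun t => η.real {x | t ≤ g x} := fun s t hst =>
      measureReal_mono fun x hx => le_trans hst hx
    exact Integrable.of_bound hanti.measurable.aestronglyMeasurable 1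
      (ae_of_all _ fun t => by
        rw [Real.norm_of_nonneg measureReal_nonneg]; exact measureReal_le_one)
  rw [hlc P, hlc Q, ← integral_sub (hI P) (hI Q), ← Real.norm_eq_abs]
  refine (norm_setIntegral_le_of_norm_le_const (C := tvDist P Q) (by simp) fun t _ => ?_).trans ?_
  · exact abs_measureReal_sub_le_tvDist (measurableSet_le measurable_const hg.measurable)
  · simp [hB0, mul_comm]

/-- Integrals of a bounded vector-valued function against two probability measures. -/
theorem norm_integral_sub_integral_le [CompleteSpace E] {g : X → E} {B : ℝ}
    (hg : StronglyMeasurable g) (hB : ∀ x, ‖g x‖ ≤ B) :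
    ‖∫ x, g x ∂P - ∫ x, g x ∂Q‖ ≤ 2 * B * tvDist P Q := by
  -- A norming functional reduces to real values in `[-B, B]`. Adding `B` makes them nonnegative
  -- with bound `2 * B`, the source of the factor.
  obtain ⟨f, hf1, hf⟩ := exists_dual_vector'' ℝ (∫ x, g x ∂P - ∫ x, g x ∂Q)
  have hint : ∀ (η : Measure X) [IsProbabilityMeasure η], Integrable g η := fun η _ =>
    Integrable.of_bound hg.aestronglyMeasurable B (ae_of_all _ hB)
  have hfb : ∀ x, |f (g x)| ≤ B := fun x =>
    ((f.le_opNorm _).trans (mul_le_of_le_one_left (norm_nonneg _) hf1)).trans (hB x)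
  have hshift : ∀ (η : Measure X) [IsProbabilityMeasure η],
      ∫ x, (f (g x) + B) ∂η = f (∫ x, g x ∂η) + B := by
    intro η _
    rw [integral_add (f.integrable_comp (hint η)) (integrable_const _),
      f.integral_comp_comm (hint η)]
    simp
  have key := abs_integral_sub_integral_le_of_nonneg (P := P) (Q := Q)
    (g := fun x => f (g x) + B) (B := 2 * B)
    ((f.continuous.comp_stronglyMeasurable hg).add stronglyMeasurable_const)
    (fun x => by linarith [(abs_le.1 (hfb x)).1]) (fun x => by linarith [(abs_le.1 (hfb x)).2])
  rw [hshift P, hshift Q] at key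
  have h2 : f (∫ x, g x ∂P) + B - (f (∫ x, g x ∂Q) + B)
      = ‖∫ x, g x ∂P - ∫ x, g x ∂Q‖ := by
    rw [add_sub_add_right_eq_sub, ← map_sub, hf]; rfl
  rw [h2] at key
  exact (le_abs_self _).trans key

end TotalVariation

instance Kernel.isMarkovKernel_pow {S : Type*} [MeasurableSpace S] (κ : Kernel S S)
    [IsMarkovKernel κ] (n : ℕ) : IsMarkovKernel (κ ^ n) := by
  induction n with
  | zero => exact inferInstanceAs (IsMarkovKernel Kernel.id)
  | succ n ih => rw [pow_succ]; exact inferInstanceAs (IsMarkovKernel ((κ ^ n) ∘ₖ κ))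

/-- Solution of the Poisson equation of a uniformly geometrically ergodic kernel. -/
theorem exists_poisson_solution {S E : Type*} [MeasurableSpace S] [NormedAddCommGroup E]
    [NormedSpace ℝ E] [CompleteSpace E] {κ : Kernel S S} [IsMarkovKernel κ] {μ : Measure S}
    [IsProbabilityMeasure μ] {m k : ℝ} (hk0 : 0 ≤ k) (hk1 : k < 1)
    (herg : ∀ (t : ℕ) (s : S), tvDist ((κ ^ t) s) μ ≤ m * k ^ t)
    {g : S → E} (hg : StronglyMeasurable g) {B : ℝ} (hB : ∀ s, ‖g s‖ ≤ B) :
    ∃ (V : S → E) (C : ℝ), StronglyMeasurable V ∧ (∀ s, ‖V s‖ ≤ C) ∧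
      ∀ s, V s - ∫ y, V y ∂(κ s) = g s - ∫ y, g y ∂μ := by
  have hint : ∀ (η : Measure S) [IsProbabilityMeasure η], Integrable g η := fun η _ =>
    Integrable.of_bound hg.aestronglyMeasurable B (ae_of_all _ hB)
  -- The solution is `V = ∑ T n`. Ergodicity makes the series converge geometrically, uniformly in
  -- the state, and integrating against `κ` shifts the index, so only `T 0 = g - ∫ g ∂μ` survives in
  -- the difference.
  set T : ℕ → S → E := fun n s => ∫ y, g y ∂((κ ^ n) s) - ∫ y, g y ∂μ with hT
  obtain ⟨s₀⟩ := μ.nonempty_of_neZero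
  have hB0 : 0 ≤ B := (norm_nonneg _).trans (hB s₀)
  have hTb : ∀ n s, ‖T n s‖ ≤ 2 * B * m * k ^ n := fun n s => by
    refine (norm_integral_sub_integral_le hg hB).trans ?_
    rw [mul_assoc (2 * B)]
    exact mul_le_mul_of_nonneg_left (herg n s) (by positivity)
  have hgeo : Summable fun n : ℕ => 2 * B * m * k ^ n :=
    (summable_geometric_of_lt_one hk0 hk1).mul_left _
  have hTsum : ∀ s, Summable fun n => T n s := fun s =>
    Summable.of_norm_bounded hgeo (fun n => hTb n s)
  have hTm : ∀ n, StronglyMeasurable (T n) := fun n =>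
    (hg.integral_kernel (κ := κ ^ n)).sub stronglyMeasurable_const
  have hTint : ∀ n s, Integrable (T n) (κ s) := fun n s =>
    Integrable.of_bound (hTm n).aestronglyMeasurable _ (ae_of_all _ (hTb n))
  have hstep : ∀ n s, ∫ y, T n y ∂(κ s) = T (n + 1) s := by
    intro n s
    have h1 : Integrable g (((κ ^ n) ∘ₖ κ) s) := hint _
    simp only [hT]
    rw [integral_sub _ (integrable_const _)]
    · rw [integral_const, ← Kernel.integral_comp h1, pow_succ]
      simp; rfl
    · exact h1.integral_comp
  refine ⟨fun s => ∑' n, T n s, ∑' n : ℕ, 2 * B * m * k ^ n, ?_, ?_, ?_⟩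
  · exact stronglyMeasurable_of_tendsto atTop
      (fun N => Finset.stronglyMeasurable_sum (Finset.range N) fun n _ => hTm n)
      (tendsto_pi_nhds.2 fun s => by
        simpa [Finset.sum_apply] using (hTsum s).hasSum.tendsto_sum_nat)
  · exact fun s => tsum_of_norm_bounded hgeo.hasSum (fun n => hTb n s)
  · intro s
    have h1 : ∫ y, ∑' n, T n y ∂(κ s) = ∑' n, T (n + 1) s := by
      rw [← integral_tsum_of_summable_integral_norm (fun n => hTint n s)]
      · exact tsum_congr fun n => hstep n s
      · refine Summable.of_nonneg_of_le (fun n => integral_nonneg fun _ => norm_nonneg _)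
          (fun n => ?_) hgeo
        calc ∫ y, ‖T n y‖ ∂(κ s) ≤ ∫ _, 2 * B * m * k ^ n ∂(κ s) :=
              integral_mono (hTint n s).norm (integrable_const _) (hTb n)
          _ = _ := by simp
    have h2 : T 0 s = g s - ∫ y, g y ∂μ := by
      simp only [hT, pow_zero]
      congr 1
      change ∫ y, g y ∂(Kernel.id s) = g s
      rw [Kernel.id_apply, integral_dirac' _ _ hg]
    simp only [h1]
    rw [(hTsum s).tsum_eq_zero_add, add_sub_cancel_right, h2]

/-! ### Conditional laws and Markovian noise along a sample path -/

namespace OffPolicyProblem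

attribute [instance] markov_P markov_π markov_πb prob_μ

variable {S A : Type*} [MeasurableSpace S] [MeasurableSpace A] {d : ℕ}
  {E : Type*} [NormedAddCommGroup E] [NormedSpace ℝ E]

instance (M : OffPolicyProblem S A d) : IsMarkovKernel M.actStep :=
  inferInstanceAs (IsMarkovKernel (M.πb ⊗ₖ M.P))

instance (M : OffPolicyProblem S A d) : IsMarkovKernel M.stateStep :=
  inferInstanceAs (IsMarkovKernel (Kernel.snd (M.πb ⊗ₖ M.P)))

instance (M : OffPolicyProblem S A d) : IsProbabilityMeasure M.obsLaw :=
  inferInstanceAs (IsProbabilityMeasure (M.μ ⊗ₘ (M.πb ⊗ₖ M.P)))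

/-- Conditional mean of an observable given the current state. -/
def condMean (M : OffPolicyProblem S A d) (g : S × A × S → E) (s : S) : E :=
  ∫ p, g (s, p) ∂(M.actStep s)

variable {M : OffPolicyProblem S A d}

theorem stronglyMeasurable_condMean {g : S × A × S → E} (hg : StronglyMeasurable g) :
    StronglyMeasurable (M.condMean g) :=
  hg.integral_kernel_prod_right' (κ := M.actStep)

theorem norm_condMean_le {g : S × A × S → E} {B : ℝ} (hB : ∀ o, ‖g o‖ ≤ B) (s : S) :
    ‖M.condMean g s‖ ≤ B := by
  unfold condMean
  simpa using norm_integral_le_of_norm_le_const (μ := M.actStep s) (f := fun p => g (s, p))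
    (ae_of_all _ fun p => hB (s, p))

theorem integral_condMean {g : S × A × S → E} (hg : StronglyMeasurable g) {B : ℝ}
    (hB : ∀ o, ‖g o‖ ≤ B) : ∫ s, M.condMean g s ∂M.μ = ∫ o, g o ∂M.obsLaw := by
  have : Integrable g (M.μ ⊗ₘ M.actStep) :=
    Integrable.of_bound hg.aestronglyMeasurable B (ae_of_all _ hB)
  exact (Measure.integral_compProd this).symm

theorem condMean_comp_next (V : S → E) (hV : StronglyMeasurable V) (s : S) :
    M.condMean (fun o => V o.2.2) s = ∫ y, V y ∂(M.stateStep s) := by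
  rw [condMean, stateStep, Kernel.snd_apply, integral_map measurable_snd.aemeasurable
    hV.aestronglyMeasurable]
  rfl

namespace IsSamplePath

variable {Ω : Type*} [mΩ : MeasurableSpace Ω] {Pr : Measure Ω}
  {ℱ : Filtration ℕ mΩ} {s : ℕ → Ω → S} {a : ℕ → Ω → A}

theorem measurable_obs (h : M.IsSamplePath Pr ℱ s a) (t : ℕ) :
    Measurable[ℱ (t + 1)] fun ω => (s t ω, a t ω, s (t + 1) ω) :=
  (((h.measurable_state t).mono (ℱ.mono t.le_succ) le_rfl)).prodMk
    ((h.measurable_action t).prodMk (h.measurable_state (t + 1)))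

/-- Restricting to an `ℱ t`-event `D` encodes conditioning on `ℱ t` as an identity of measures,
which then integrates vector-valued observables. Rectangles `U × B` suffice, and there the claim is
the conditional law integrated over `s t ⁻¹' U ∩ D`. -/
theorem map_restrict_obs [IsProbabilityMeasure Pr] (h : M.IsSamplePath Pr ℱ s a) (t : ℕ) {D : Set Ω}
    (hD : MeasurableSet[ℱ t] D) :
    (Pr.restrict D).map (fun ω => (s t ω, a t ω, s (t + 1) ω))
      = ((Pr.restrict D).map (s t)) ⊗ₘ M.actStep := by
  have hs : Measurable (s t) := (h.measurable_state t).mono (ℱ.le t) le_rfl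
  have ho : Measurable fun ω => (s t ω, a t ω, s (t + 1) ω) :=
    (h.measurable_obs t).mono (ℱ.le _) le_rfl
  have hp : Measurable fun ω => (a t ω, s (t + 1) ω) := measurable_snd.comp ho
  refine Measure.ext_prod fun {U B} hU hB => ?_
  rw [Measure.compProd_apply_prod hU hB, Measure.map_apply ho (hU.prod hB)]
  rw [setLIntegral_map hU (Kernel.measurable_coe _ hB) hs,
    Measure.restrict_restrict (hs hU)]
  have hUD : MeasurableSet[ℱ t] (s t ⁻¹' U ∩ D) := (h.measurable_state t hU).inter hD
  have hpre : (fun ω => (s t ω, a t ω, s (t + 1) ω)) ⁻¹' U ×ˢ B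
      = s t ⁻¹' U ∩ (fun ω => (a t ω, s (t + 1) ω)) ⁻¹' B := by
    ext ω; simp
  rw [hpre, Measure.restrict_apply ((hs hU).inter (hp hB))]
  have hint : Integrable
      (((fun ω => (a t ω, s (t + 1) ω)) ⁻¹' B).indicator (fun _ => (1 : ℝ))) Pr :=
    (integrable_const _).indicator (hp hB)
  have key := setIntegral_condExp (ℱ.le t) hint hUD
  rw [setIntegral_congr_ae (ℱ.le t _ hUD) ((h.cond_law t B hB).mono fun ω hω _ => hω),
    setIntegral_indicator (hp hB)] at key
  simp only [integral_const, smul_eq_mul, mul_one, MeasurableSet.univ, measureReal_restrict_apply,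
    univ_inter] at key
  have hlin : ∫⁻ ω in s t ⁻¹' U ∩ D, M.actStep (s t ω) B ∂Pr
      = ENNReal.ofReal (∫ ω in s t ⁻¹' U ∩ D, (M.actStep (s t ω)).real B ∂Pr) := by
    rw [ofReal_integral_eq_lintegral_ofReal]
    · simp
    · exact Integrable.of_bound
        (((Kernel.measurable_coe _ hB).comp hs).ennreal_toReal.aestronglyMeasurable) 1
        (ae_of_all _ fun ω => by
          rw [Real.norm_of_nonneg measureReal_nonneg]; exact measureReal_le_one)
    · exact ae_of_all _ fun ω => measureReal_nonneg
  rw [hlin, key, ofReal_measureReal]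
  congr 1
  ext ω; simp only [mem_inter_iff]; tauto

theorem condExp_obs [CompleteSpace E] [IsProbabilityMeasure Pr]
    (h : M.IsSamplePath Pr ℱ s a) (t : ℕ) {g : S × A × S → E}
    (hg : StronglyMeasurable g) {B : ℝ} (hB : ∀ o, ‖g o‖ ≤ B) :
    Pr[fun ω => g (s t ω, a t ω, s (t + 1) ω) | ℱ t] =ᵐ[Pr] fun ω => M.condMean g (s t ω) := by
  have hs : Measurable (s t) := (h.measurable_state t).mono (ℱ.le t) le_rfl
  have ho : Measurable fun ω => (s t ω, a t ω, s (t + 1) ω) :=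
    (h.measurable_obs t).mono (ℱ.le _) le_rfl
  have hm := stronglyMeasurable_condMean (M := M) hg
  symm
  refine ae_eq_condExp_of_forall_setIntegral_eq (ℱ.le t) ?_ (fun D _ _ => ?_) (fun D hD _ => ?_) ?_
  · exact Integrable.of_bound (hg.comp_measurable ho).aestronglyMeasurable B
      (ae_of_all _ fun ω => hB _)
  · exact (Integrable.of_bound (hm.comp_measurable hs).aestronglyMeasurable B
      (ae_of_all _ fun ω => norm_condMean_le hB _)).integrableOn
  · have hint : Integrable g (((Pr.restrict D).map (s t)) ⊗ₘ M.actStep) :=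
      Integrable.of_bound hg.aestronglyMeasurable B (ae_of_all _ hB)
    rw [← integral_map (μ := Pr.restrict D) ho.aemeasurable hg.aestronglyMeasurable,
      ← integral_map (μ := Pr.restrict D) hs.aemeasurable hm.aestronglyMeasurable,
      h.map_restrict_obs t hD, Measure.integral_compProd hint]
    rfl
  · exact (hm.comp_measurable (h.measurable_state t)).aestronglyMeasurable

/-- The functional is known at time `t`, so it can be pulled out of the conditional expectation and
only the conditional mean of the observable remains. -/
theorem integral_functional_obs [CompleteSpace E] [IsProbabilityMeasure Pr]
    (h : M.IsSamplePath Pr ℱ s a) (t : ℕ) {g : S × A × S → E}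
    (hg : StronglyMeasurable g) {B : ℝ} (hB : ∀ o, ‖g o‖ ≤ B) {Y : Ω → E →L[ℝ] ℝ}
    (hY : StronglyMeasurable[ℱ t] Y) {BY : ℝ} (hBY : ∀ ω, ‖Y ω‖ ≤ BY) :
    ∫ ω, Y ω (g (s t ω, a t ω, s (t + 1) ω)) ∂Pr = ∫ ω, Y ω (M.condMean g (s t ω)) ∂Pr := by
  have ho : Measurable fun ω => (s t ω, a t ω, s (t + 1) ω) :=
    (h.measurable_obs t).mono (ℱ.le _) le_rfl
  have hgo := hg.comp_measurable ho
  have hint : Integrable (fun ω => g (s t ω, a t ω, s (t + 1) ω)) Pr :=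
    Integrable.of_bound hgo.aestronglyMeasurable B (ae_of_all _ fun ω => hB _)
  have hYg : Integrable (fun ω => Y ω (g (s t ω, a t ω, s (t + 1) ω))) Pr := by
    refine Integrable.of_bound (C := BY * B) ?_ (ae_of_all _ fun ω => ?_)
    · exact ((ContinuousLinearMap.id ℝ (E →L[ℝ] ℝ)).aestronglyMeasurable_comp₂
        (hY.mono (ℱ.le t)).aestronglyMeasurable hgo.aestronglyMeasurable)
    · exact (Y ω).le_of_opNorm_le_of_le (hBY ω) (hB _)
  have hpull := condExp_bilin_of_stronglyMeasurable_left (μ := Pr)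
    (ContinuousLinearMap.id ℝ (E →L[ℝ] ℝ)) hY hYg hint
  rw [← integral_condExp (ℱ.le t)]
  refine integral_congr_ae ?_
  filter_upwards [hpull, h.condExp_obs t hg hB] with ω h1 h2
  rw [h2] at h1
  exact h1

end IsSamplePath

/-- The Markovian noise of a bounded observable, tested against an adapted bounded functional,
telescopes up to the increments of the functional. -/
theorem exists_noise_bound [CompleteSpace E] (herg : M.GeometricallyErgodic) {g : S × A × S → E}
    (hg : StronglyMeasurable g) {B : ℝ} (hB : ∀ o, ‖g o‖ ≤ B) :
    ∃ C : ℝ, 0 ≤ C ∧ ∀ (Ω : Type*) [mΩ : MeasurableSpace Ω] (Pr : Measure Ω)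
      [IsProbabilityMeasure Pr] (ℱ : Filtration ℕ mΩ) (s : ℕ → Ω → S) (a : ℕ → Ω → A),
      M.IsSamplePath Pr ℱ s a → ∀ (Y : ℕ → Ω → E →L[ℝ] ℝ) (BY : ℝ),
        (∀ t, StronglyMeasurable[ℱ t] (Y t)) → (∀ t, 1 ≤ t → ∀ ω, ‖Y t ω‖ ≤ BY) →
        ∃ D : ℕ → ℝ, (∀ t, 1 ≤ t → |D t| ≤ BY * C) ∧ ∀ t, 1 ≤ t → ∀ η : ℝ,
          (∀ ω, ‖Y (t + 1) ω - Y t ω‖ ≤ η) →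
          ∫ ω, Y t ω (g (s t ω, a t ω, s (t + 1) ω) - ∫ o, g o ∂M.obsLaw) ∂Pr
            ≤ D t - D (t + 1) + η * C := by
  obtain ⟨m, k, -, hk0, hk1, herg⟩ := herg
  -- The Poisson equation lives on the state chain, hence it is solved for the conditional mean of
  -- `g`. Its bound `C` is fixed before the sample path, so it is uniform over paths and initial
  -- laws.
  obtain ⟨V, C, hV, hVC, hPois⟩ := exists_poisson_solution hk0.le hk1 herg
    (stronglyMeasurable_condMean (M := M) hg) (norm_condMean_le hB)
  have hC : 0 ≤ C := by
    obtain ⟨s⟩ := M.μ.nonempty_of_neZero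
    exact (norm_nonneg _).trans (hVC s)
  refine ⟨C, hC, ?_⟩
  intro Ω mΩ Pr _ ℱ s a h Y BY hY hBY
  have hs : ∀ t, Measurable (s t) := fun t => (h.measurable_state t).mono (ℱ.le t) le_rfl
  have hVs : ∀ t, StronglyMeasurable fun ω => V (s t ω) := fun t => hV.comp_measurable (hs t)
  have hYm : ∀ t, StronglyMeasurable (Y t) := fun t => (hY t).mono (ℱ.le t)
  have hmeas : ∀ {t : ℕ} {f : Ω → E}, StronglyMeasurable f →
      StronglyMeasurable fun ω => Y t ω (f ω) := fun {t f} hf =>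
    isBoundedBilinearMap_apply.continuous.comp_stronglyMeasurable ((hYm t).prodMk hf)
  have hint : ∀ {t : ℕ} {f : Ω → E} {b : ℝ}, 1 ≤ t → StronglyMeasurable f → (∀ ω, ‖f ω‖ ≤ b) →
      Integrable (fun ω => Y t ω (f ω)) Pr := fun {t f b} ht hf hb =>
    Integrable.of_bound (hmeas hf).aestronglyMeasurable (BY * b)
      (ae_of_all _ fun ω => (Y t ω).le_of_opNorm_le_of_le (hBY t ht ω) (hb ω))
  -- The telescoping quantity is `D t = E Y_t(V(s_t))`.
  refine ⟨fun t => ∫ ω, Y t ω (V (s t ω)) ∂Pr, fun t ht => ?_, fun t ht η hη => ?_⟩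
  · simpa using norm_integral_le_of_norm_le_const (μ := Pr) (f := fun ω => Y t ω (V (s t ω)))
      (ae_of_all _ fun ω => (Y t ω).le_of_opNorm_le_of_le (hBY t ht ω) (hVC _))
  · have ho : Measurable fun ω => (s t ω, a t ω, s (t + 1) ω) :=
      (h.measurable_obs t).mono (ℱ.le _) le_rfl
    have hmean : ∫ o, g o ∂M.obsLaw = ∫ y, M.condMean g y ∂M.μ := (integral_condMean hg hB).symm
    have hcm : StronglyMeasurable fun ω => M.condMean g (s t ω) :=
      (stronglyMeasurable_condMean hg).comp_measurable (hs t)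
    have hnext : ∫ ω, Y t ω (V (s (t + 1) ω)) ∂Pr
        = ∫ ω, Y t ω (∫ y, V y ∂(M.stateStep (s t ω))) ∂Pr := by
      have hV' : StronglyMeasurable fun o : S × A × S => V o.2.2 :=
        hV.comp_measurable (measurable_snd.comp measurable_snd)
      rw [h.integral_functional_obs t hV' (fun o => hVC _) (hY t) (hBY t ht)]
      simp_rw [condMean_comp_next V hV]
    have hPV : StronglyMeasurable fun ω => ∫ y, V y ∂(M.stateStep (s t ω)) :=
      (hV.integral_kernel (κ := M.stateStep)).comp_measurable (hs t)
    have hPVb : ∀ ω, ‖∫ y, V y ∂(M.stateStep (s t ω))‖ ≤ C := fun ω => by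
      simpa using norm_integral_le_of_norm_le_const (μ := M.stateStep (s t ω)) (f := V)
        (ae_of_all _ hVC)
    -- Conditioning on `ℱ t` turns `g` into its conditional mean and `V(s_{t+1})` into the
    -- transition average of `V`; the Poisson equation identifies the two sides.
    have e1 : ∫ ω, Y t ω (g (s t ω, a t ω, s (t + 1) ω) - ∫ o, g o ∂M.obsLaw) ∂Pr
        = ∫ ω, Y t ω (V (s t ω)) ∂Pr - ∫ ω, Y t ω (V (s (t + 1) ω)) ∂Pr := by
      rw [hnext, ← integral_sub (hint ht (hVs t) fun ω => hVC _) (hint ht hPV hPVb)]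
      simp_rw [← map_sub, hPois, ← hmean, map_sub]
      have hconst : Integrable (fun ω => Y t ω (∫ o, g o ∂M.obsLaw)) Pr :=
        hint ht stronglyMeasurable_const (fun _ => le_rfl)
      have hgo : StronglyMeasurable fun ω => g (s t ω, a t ω, s (t + 1) ω) :=
        hg.comp_measurable ho
      rw [integral_sub (hint ht hgo fun ω => hB _) hconst,
        integral_sub (hint ht hcm fun ω => norm_condMean_le hB _) hconst,
        h.integral_functional_obs t hg hB (hY t) (hBY t ht)]
    -- Completing the telescope requires `Y_{t+1}` in front of `V(s_{t+1})`; the exchange costs the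
    -- increment `η` times the bound of `V`.
    have e2 : ∫ ω, Y (t + 1) ω (V (s (t + 1) ω)) ∂Pr - ∫ ω, Y t ω (V (s (t + 1) ω)) ∂Pr
        ≤ η * C := by
      rw [← integral_sub (hint (by omega) (hVs _) fun ω => hVC _)
        (hint ht (hVs _) fun ω => hVC _)]
      refine (le_abs_self _).trans ?_
      simpa using norm_integral_le_of_norm_le_const (μ := Pr)
        (f := fun ω => Y (t + 1) ω (V (s (t + 1) ω)) - Y t ω (V (s (t + 1) ω)))
        (ae_of_all _ fun ω => (Y (t + 1) ω - Y t ω).le_of_opNorm_le_of_le (hη ω) (hVC _))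
    rw [e1]
    linarith

end OffPolicyProblem

/-! ### Spectral bounds and mean fields -/

/-- The largest spectral value of a symmetric operator bounds its quadratic form. -/
theorem inner_apply_self_le_of_spectrum_le {E : Type*} [NormedAddCommGroup E]
    [InnerProductSpace ℝ E] [FiniteDimensional ℝ E] {T : E →L[ℝ] E}
    (hT : (T : E →ₗ[ℝ] E).IsSymmetric) {l : ℝ} (hl : ∀ x ∈ spectrum ℝ T, x ≤ l) (x : E) :
    inner ℝ (T x) x ≤ l * ‖x‖ ^ 2 := by
  rcases eq_or_ne x 0 with rfl | hx
  · simp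
  have : Nontrivial E := ⟨x, 0, hx⟩
  -- In finite dimension the supremum of the Rayleigh quotient is an eigenvalue, so the spectral
  -- bound controls every quotient.
  have hev := hT.hasEigenvalue_iSup_of_finiteDimensional
  set r : ℝ := ⨆ x : { x : E // x ≠ 0 }, RCLike.re (inner ℝ ((T : E →ₗ[ℝ] E) x) x) / ‖(x : E)‖ ^ 2
    with hr
  have hmem : r ∈ spectrum ℝ T := by
    obtain ⟨v, hv⟩ := hev.exists_hasEigenvector
    rw [spectrum.mem_iff]
    rintro ⟨u, hu⟩
    apply hv.2
    have h1 : (u : E →L[ℝ] E) v = 0 := by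
      rw [hu]
      have := hv.apply_eq_smul
      simp only [ContinuousLinearMap.coe_coe, RCLike.ofReal_real_eq_id, id_eq] at this
      simp [Algebra.algebraMap_eq_smul_one, this]
    have h2 : ((u⁻¹ : (E →L[ℝ] E)ˣ) : E →L[ℝ] E) ((u : E →L[ℝ] E) v) = v := by
      rw [← mul_apply_eq_comp, Units.inv_mul, one_apply_eq_self]
    rw [← h2, h1, map_zero]
  have hbdd : BddAbove (range fun x : { x : E // x ≠ 0 } =>
      RCLike.re (inner ℝ ((T : E →ₗ[ℝ] E) x) x) / ‖(x : E)‖ ^ 2) := by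
    refine ⟨‖T‖, ?_⟩
    rintro _ ⟨y, rfl⟩
    have hy : 0 < ‖(y : E)‖ := norm_pos_iff.2 y.2
    rw [div_le_iff₀ (by positivity)]
    calc inner ℝ (T y) (y : E) ≤ ‖T y‖ * ‖(y : E)‖ := real_inner_le_norm _ _
      _ ≤ ‖T‖ * ‖(y : E)‖ * ‖(y : E)‖ := by gcongr; exact T.le_opNorm _
      _ = _ := by ring
  have h3 : inner ℝ (T x) x / ‖x‖ ^ 2 ≤ l := (le_ciSup hbdd ⟨x, hx⟩).trans (hl r hmem)
  rwa [div_le_iff₀ (by have := norm_pos_iff.2 hx; positivity)] at h3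

namespace OffPolicyProblem

variable {S A : Type*} [MeasurableSpace S] [MeasurableSpace A] {d : ℕ}
  {M : OffPolicyProblem S A d}

theorem stronglyMeasurable_φ : StronglyMeasurable M.φ := M.measurable_φ.stronglyMeasurable

theorem exists_abs_ρ_le (hfeat : M.BoundedFeatures) : ∃ R, 0 ≤ R ∧ ∀ s a, |M.ρ s a| ≤ R := by
  obtain ⟨-, R, hR⟩ := hfeat
  refine ⟨|R|, abs_nonneg _, fun s a => ?_⟩
  rw [ρ, abs_of_nonneg (div_nonneg measureReal_nonneg measureReal_nonneg)]
  -- Division by zero returns `0`, so the bound also covers actions of zero behavior probability.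
  refine div_le_of_le_mul₀ measureReal_nonneg (abs_nonneg _) ((hR s a).trans ?_)
  exact mul_le_mul_of_nonneg_right (le_abs_self _) measureReal_nonneg

theorem exists_norm_le (hfeat : M.BoundedFeatures) :
    ∃ B, 0 ≤ B ∧ ∀ o, ‖M.matA o‖ ≤ B ∧ ‖M.matB o‖ ≤ B ∧ ‖M.matC o‖ ≤ B ∧ ‖M.vecb o‖ ≤ B := by
  obtain ⟨R, hR0, hR⟩ := exists_abs_ρ_le hfeat
  obtain ⟨rm, hrm⟩ := M.bounded_r
  have hφ := hfeat.1
  have hγ := M.γ_pos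
  have hγ1 := M.γ_lt_one
  refine ⟨R * 2 + 1 + R * |rm|, by positivity, fun o => ?_⟩
  have hrm' : |M.r o| ≤ |rm| := (hrm o).trans (le_abs_self _)
  have hx : 0 ≤ R * |rm| := by positivity
  have h1 : ‖M.φ o.1‖ ≤ 1 := hφ _
  have h2 : ‖M.φ o.2.2‖ ≤ 1 := hφ _
  have hρ := hR o.1 o.2.1
  refine ⟨?_, ?_, ?_, ?_⟩
  · rw [matA, norm_smul, InnerProductSpace.norm_rankOne, Real.norm_eq_abs]
    have h3 : ‖M.γ • M.φ o.2.2 - M.φ o.1‖ ≤ 2 := by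
      refine (norm_sub_le _ _).trans ?_
      rw [norm_smul, Real.norm_of_nonneg hγ.le]
      nlinarith [norm_nonneg (M.φ o.2.2)]
    have : |M.ρ o.1 o.2.1| * (‖M.φ o.1‖ * ‖M.γ • M.φ o.2.2 - M.φ o.1‖) ≤ R * (1 * 2) := by gcongr
    linarith
  · rw [matB, norm_neg, norm_smul, InnerProductSpace.norm_rankOne, Real.norm_eq_abs, abs_mul,
      abs_of_pos hγ]
    have : M.γ * |M.ρ o.1 o.2.1| * (‖M.φ o.2.2‖ * ‖M.φ o.1‖) ≤ 1 * R * (1 * 1) := by gcongr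
    linarith
  · rw [matC, norm_neg, InnerProductSpace.norm_rankOne]
    have : ‖M.φ o.1‖ * ‖M.φ o.1‖ ≤ 1 * 1 := by gcongr
    linarith
  · rw [vecb, norm_smul, Real.norm_eq_abs, abs_mul]
    have : |M.ρ o.1 o.2.1| * |M.r o| * ‖M.φ o.1‖ ≤ R * |rm| * 1 := by gcongr
    linarith

section Measurability

theorem continuous_rankOne : Continuous fun p : Param d × Param d =>
    (InnerProductSpace.rankOne ℝ p.1 p.2 : Param d →L[ℝ] Param d) := by
  simp only [InnerProductSpace.rankOne_def]
  have h := (ContinuousLinearMap.smulRightL ℝ (Param d) (Param d)).continuous₂.comp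
    (((innerSL ℝ).continuous.comp continuous_snd).prodMk continuous_fst :
      Continuous fun p : Param d × Param d => (innerSL ℝ p.2, p.1))
  exact h

theorem stronglyMeasurable_rankOne {X : Type*} [MeasurableSpace X] {f g : X → Param d}
    (hf : StronglyMeasurable f) (hg : StronglyMeasurable g) :
    StronglyMeasurable fun o =>
      (InnerProductSpace.rankOne ℝ (f o) (g o) : Param d →L[ℝ] Param d) := by
  have h := hf.prodMk hg
  have h2 := Continuous.comp_stronglyMeasurable (continuous_rankOne (d := d)) h
  exact h2

theorem stronglyMeasurable_matC : StronglyMeasurable M.matC := by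
  have h : StronglyMeasurable fun o : S × A × S => M.φ o.1 :=
    stronglyMeasurable_φ.comp_measurable measurable_fst
  exact (stronglyMeasurable_rankOne h h).neg

variable [Finite A] [MeasurableSingletonClass A]

theorem measurable_ρ : Measurable fun p : S × A => M.ρ p.1 p.2 := by
  refine measurable_from_prod_countable_left fun a => ?_
  exact ((Kernel.measurable_coe M.π (measurableSet_singleton a)).ennreal_toReal).div
    ((Kernel.measurable_coe M.πb (measurableSet_singleton a)).ennreal_toReal)

theorem stronglyMeasurable_ρ : StronglyMeasurable fun o : S × A × S => M.ρ o.1 o.2.1 :=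
  (measurable_ρ.comp (measurable_fst.prodMk (measurable_fst.comp measurable_snd))
    : Measurable fun o : S × A × S => M.ρ o.1 o.2.1).stronglyMeasurable

theorem stronglyMeasurable_obs :
    StronglyMeasurable M.matA ∧ StronglyMeasurable M.matB ∧ StronglyMeasurable M.vecb := by
  have h : StronglyMeasurable fun o : S × A × S => M.φ o.1 :=
    stronglyMeasurable_φ.comp_measurable measurable_fst
  have h' : StronglyMeasurable fun o : S × A × S => M.φ o.2.2 :=
    stronglyMeasurable_φ.comp_measurable (measurable_snd.comp measurable_snd)
  have hρ := stronglyMeasurable_ρ (M := M)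
  refine ⟨?_, ?_, ?_⟩
  · exact hρ.smul (stronglyMeasurable_rankOne h ((h'.const_smul M.γ).sub h))
  · exact ((hρ.const_mul M.γ).smul (stronglyMeasurable_rankOne h' h)).neg
  · exact (hρ.mul M.measurable_r.stronglyMeasurable).smul h

end Measurability

/-- `B = -γ E[ρ φ(s') φ(s)ᵀ]` -/
def meanB (M : OffPolicyProblem S A d) : Param d →L[ℝ] Param d := ∫ o, M.matB o ∂M.obsLaw

theorem inner_integral_apply {G : S × A × S → Param d →L[ℝ] Param d} (hG : StronglyMeasurable G)
    {B : ℝ} (hB : ∀ o, ‖G o‖ ≤ B) (x y : Param d) :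
    inner ℝ x ((∫ o, G o ∂M.obsLaw) y) = ∫ o, inner ℝ x (G o y) ∂M.obsLaw := by
  have hint : Integrable G M.obsLaw :=
    Integrable.of_bound hG.aestronglyMeasurable B (ae_of_all _ hB)
  exact (((innerSL ℝ x) ∘L (ContinuousLinearMap.apply ℝ (Param d) y)).integral_comp_comm
    hint).symm

section ImportanceSampling

variable [Finite A] [MeasurableSingletonClass A]

/-- The weight cancels the behavior probability and leaves the total mass of `π`. Actions with zero
behavior probability contribute nothing on either side, since the bounded-weight condition forces
`π` to vanish there. -/
theorem integral_ρ_πb (hfeat : M.BoundedFeatures) (s : S) : ∫ a, M.ρ s a ∂(M.πb s) = 1 := by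
  obtain ⟨-, R, hR⟩ := hfeat
  have := Fintype.ofFinite A
  rw [integral_fintype .of_finite]
  have : ∀ a, (M.πb s).real {a} • M.ρ s a = (M.π s).real {a} := by
    intro a
    rw [ρ, smul_eq_mul]
    rcases eq_or_ne ((M.πb s).real {a}) 0 with h | h
    · have h1 := hR s a
      rw [h, mul_zero] at h1
      rw [h, zero_mul]
      exact le_antisymm measureReal_nonneg h1
    · rw [mul_div_cancel₀ _ h]
  simp_rw [this]
  rw [sum_measureReal_singleton]
  simp

theorem integral_ρ_mul (hfeat : M.BoundedFeatures) {f : S → ℝ} (hf : StronglyMeasurable f) {B : ℝ}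
    (hB : ∀ s, ‖f s‖ ≤ B) :
    ∫ o, M.ρ o.1 o.2.1 * f o.1 ∂M.obsLaw = ∫ o, f o.1 ∂M.obsLaw := by
  obtain ⟨R, hR0, hR⟩ := exists_abs_ρ_le hfeat
  have hf1 : StronglyMeasurable fun o : S × A × S => f o.1 := hf.comp_measurable measurable_fst
  have hρf : StronglyMeasurable fun o : S × A × S => M.ρ o.1 o.2.1 * f o.1 :=
    stronglyMeasurable_ρ.mul hf1
  rw [← integral_condMean (B := R * B) hρf (fun o => ?_),
    ← integral_condMean hf1 (fun o => hB _)]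
  · congr 1 with s
    have hρs : StronglyMeasurable fun a => M.ρ s a :=
      (measurable_ρ.comp measurable_prodMk_left : Measurable fun a => M.ρ s a).stronglyMeasurable
    have h1 : ∫ p, M.ρ s p.1 ∂(M.actStep s) = ∫ a, M.ρ s a ∂(M.πb s) := by
      rw [← integral_map (μ := M.actStep s) (φ := Prod.fst) measurable_fst.aemeasurable
        hρs.aestronglyMeasurable, ← Kernel.fst_apply, actStep, Kernel.fst_compProd]
    simp only [condMean]
    rw [integral_mul_const, h1, integral_ρ_πb hfeat]
    simp
  · rw [norm_mul]
    exact mul_le_mul (hR _ _) (hB _) (norm_nonneg _) hR0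

/-- Pointwise, `matB` plus the transpose of `matA` equals `-ρ φ(s) φ(s)ᵀ`, since the terms with
`φ(s')` cancel. The weight integrates to one given `s`, which leaves `C`. -/
theorem meanB_eq (hfeat : M.BoundedFeatures) :
    M.meanB = M.meanC - ContinuousLinearMap.adjoint M.meanA := by
  obtain ⟨B, hB0, hB⟩ := exists_norm_le hfeat
  obtain ⟨hA, hBm, -⟩ := stronglyMeasurable_obs (M := M)
  have hC := stronglyMeasurable_matC (M := M)
  ext1 x
  refine ext_inner_left ℝ fun y => ?_
  rw [sub_apply, inner_sub_right, ContinuousLinearMap.adjoint_inner_right,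
    real_inner_comm x, meanA, meanB, meanC, inner_integral_apply hA (fun o => (hB o).1),
    inner_integral_apply hBm (fun o => (hB o).2.1), inner_integral_apply hC (fun o => (hB o).2.2.1)]
  have hint : ∀ {G : S × A × S → Param d →L[ℝ] Param d} (_ : StronglyMeasurable G)
      (_ : ∀ o, ‖G o‖ ≤ B) (x y : Param d), Integrable (fun o => inner ℝ x (G o y)) M.obsLaw :=
    fun {G} hG hGB x y =>
      ((innerSL ℝ x) ∘L (ContinuousLinearMap.apply ℝ (Param d) y)).integrable_comp
        (Integrable.of_bound hG.aestronglyMeasurable B (ae_of_all _ hGB))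
  rw [eq_sub_iff_add_eq, ← integral_add (hint hBm (fun o => (hB o).2.1) y x)
    (hint hA (fun o => (hB o).1) x y)]
  have hφ := stronglyMeasurable_φ (M := M)
  have key := integral_ρ_mul hfeat
    (f := fun s => -(inner ℝ (M.φ s) x * inner ℝ (M.φ s) y)) (B := ‖x‖ * ‖y‖)
    ((hφ.inner stronglyMeasurable_const).mul (hφ.inner stronglyMeasurable_const)).neg ?_
  · convert key using 2
    · ext o
      simp only [matA, matB, neg_apply, smul_apply,
        InnerProductSpace.rankOne_apply, inner_neg_right, inner_smul_right, inner_sub_left,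
        inner_smul_left, RCLike.conj_to_real]
      rw [real_inner_comm (M.φ o.1) x, real_inner_comm (M.φ o.2.2) y]
      ring
    · ext o
      simp only [matC, neg_apply, InnerProductSpace.rankOne_apply,
        inner_neg_right, inner_smul_right]
      rw [real_inner_comm (M.φ o.1) y]
  · intro s
    rw [norm_neg, norm_mul]
    have h1 := hfeat.1 s
    gcongr
    · exact (norm_inner_le_norm _ _).trans (mul_le_of_le_one_left (norm_nonneg _) h1)
    · exact (norm_inner_le_norm _ _).trans (mul_le_of_le_one_left (norm_nonneg _) h1)

end ImportanceSampling

theorem adjoint_meanC (hfeat : M.BoundedFeatures) :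
    ContinuousLinearMap.adjoint M.meanC = M.meanC := by
  obtain ⟨B, hB0, hB⟩ := exists_norm_le hfeat
  have hC := stronglyMeasurable_matC (M := M)
  ext1 x
  refine ext_inner_left ℝ fun y => ?_
  rw [ContinuousLinearMap.adjoint_inner_right, real_inner_comm x, meanC,
    inner_integral_apply hC (fun o => (hB o).2.2.1),
    inner_integral_apply hC (fun o => (hB o).2.2.1)]
  congr 1 with o
  simp only [matC, neg_apply, InnerProductSpace.rankOne_apply,
    inner_neg_right, inner_smul_right, real_inner_comm (M.φ o.1)]
  ring

theorem meanC_mul_invC (hsolv : M.Solvable) : M.meanC * M.invC = 1 :=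
  Ring.mul_inverse_cancel _ hsolv.2

theorem adjoint_invC (hsolv : M.Solvable) (hfeat : M.BoundedFeatures) :
    ContinuousLinearMap.adjoint M.invC = M.invC := by
  have h1 : ContinuousLinearMap.adjoint M.invC * M.meanC = 1 := by
    have h2 := congrArg star (meanC_mul_invC hsolv)
    rw [star_mul, star_one, ContinuousLinearMap.star_eq_adjoint,
      ContinuousLinearMap.star_eq_adjoint, adjoint_meanC hfeat] at h2
    exact h2
  calc _ = ContinuousLinearMap.adjoint M.invC * (M.meanC * M.invC) := by
        rw [meanC_mul_invC hsolv, mul_one]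
    _ = M.invC := by rw [← mul_assoc, h1, one_mul]

theorem meanA_θstar (hsolv : M.Solvable) : M.meanA M.θstar = -M.meanb := by
  rw [θstar, map_neg, ← mul_apply_eq_comp, Ring.mul_inverse_cancel _ hsolv.1,
    one_apply_eq_self]

theorem meanb_add_meanA (hsolv : M.Solvable) (θ : Param d) :
    M.meanb + M.meanA θ = M.meanA (θ - M.θstar) := by
  rw [map_sub, meanA_θstar hsolv, sub_neg_eq_add, add_comm]

theorem meanC_ψ (hsolv : M.Solvable) (θ : Param d) :
    M.meanC (M.ψ θ) = -(M.meanb + M.meanA θ) := by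
  rw [ψ, map_neg, ← mul_apply_eq_comp, meanC_mul_invC hsolv,
    one_apply_eq_self]

/-- Mean direction of the fast iterate. -/
theorem mean_fast (hsolv : M.Solvable) (θ w : Param d) :
    M.meanA θ + M.meanb + M.meanC w = M.meanC (w - M.ψ θ) := by
  rw [map_sub, meanC_ψ hsolv]; abel

/-- Mean direction of the slow iterate. -/
theorem mean_slow [Finite A] [MeasurableSingletonClass A] (hsolv : M.Solvable)
    (hfeat : M.BoundedFeatures) (θ w : Param d) :
    M.meanA θ + M.meanb + M.meanB w
      = (ContinuousLinearMap.adjoint M.meanA * M.invC * M.meanA) (θ - M.θstar)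
        + M.meanB (w - M.ψ θ) := by
  -- Since `B = C - Aᵀ`, the `C` part produces `-(b + A θ)`, which cancels the uncorrected drift and
  -- leaves the symmetric operator `Aᵀ C⁻¹ A`.
  have h1 : M.meanB (M.ψ θ) = -(M.meanb + M.meanA θ)
      + ContinuousLinearMap.adjoint M.meanA (M.invC (M.meanb + M.meanA θ)) := by
    rw [meanB_eq hfeat, sub_apply, meanC_ψ hsolv, ψ, map_neg, sub_neg_eq_add]
  rw [map_sub M.meanB, h1]
  simp only [mul_apply_eq_comp]
  rw [← meanb_add_meanA hsolv]
  abel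

theorem inner_meanC_le (hfeat : M.BoundedFeatures) {lw : ℝ} (hlw : M.FastRate lw) (x : Param d) :
    2 * inner ℝ (M.meanC x) x ≤ lw * ‖x‖ ^ 2 := by
  have hsym : (((2 : ℝ) • M.meanC : Param d →L[ℝ] Param d) : Param d →ₗ[ℝ] Param d).IsSymmetric := by
    refine ContinuousLinearMap.isSelfAdjoint_iff_isSymmetric.1 ?_
    rw [ContinuousLinearMap.isSelfAdjoint_iff', map_smulₛₗ, adjoint_meanC hfeat]
    rfl
  simpa [inner_smul_left] using inner_apply_self_le_of_spectrum_le hsym hlw.2 x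

theorem inner_slow_le (hsolv : M.Solvable) (hfeat : M.BoundedFeatures) {lθ : ℝ}
    (hlθ : M.SlowRate lθ) (x : Param d) :
    2 * inner ℝ ((ContinuousLinearMap.adjoint M.meanA * M.invC * M.meanA) x) x ≤ lθ * ‖x‖ ^ 2 := by
  set T := ContinuousLinearMap.adjoint M.meanA * M.invC * M.meanA with hT
  have hadj : ContinuousLinearMap.adjoint T = T := by
    rw [← ContinuousLinearMap.star_eq_adjoint, hT, star_mul, star_mul,
      ContinuousLinearMap.star_eq_adjoint, ContinuousLinearMap.star_eq_adjoint,
      ContinuousLinearMap.star_eq_adjoint, adjoint_invC hsolv hfeat,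
      ContinuousLinearMap.adjoint_adjoint, mul_assoc]
  have hsym : (((2 : ℝ) • T : Param d →L[ℝ] Param d) : Param d →ₗ[ℝ] Param d).IsSymmetric := by
    refine ContinuousLinearMap.isSelfAdjoint_iff_isSymmetric.1 ?_
    rw [ContinuousLinearMap.isSelfAdjoint_iff', map_smulₛₗ, hadj]
    rfl
  simpa [inner_smul_left] using inner_apply_self_le_of_spectrum_le hsym hlθ.2 x

theorem ψ_sub_ψ (θ θ' : Param d) : M.ψ θ - M.ψ θ' = -M.invC (M.meanA (θ - θ')) := by
  simp only [ψ, map_sub, map_add]; abel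

theorem norm_ψ_sub_ψ_le (θ θ' : Param d) :
    ‖M.ψ θ - M.ψ θ'‖ ≤ ‖M.invC‖ * ‖M.meanA‖ * ‖θ - θ'‖ := by
  rw [ψ_sub_ψ, norm_neg, mul_assoc]
  exact M.invC.le_opNorm_of_le (M.meanA.le_opNorm _)

/-- `ψ θ = -C⁻¹ A (θ - θ*)` and `‖θ - θ*‖ ≤ 2 * Rθ`, whence the factor `2` in the condition on `Rw`.
The target of the fast iterate thus lies in the projection ball. -/
theorem norm_ψ_le (hsolv : M.Solvable) {Rθ Rw : ℝ} (hRθ : ‖M.θstar‖ ≤ Rθ)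
    (hRw : 2 * ‖M.invC‖ * ‖M.meanA‖ * Rθ ≤ Rw) {θ : Param d} (hθ : ‖θ‖ ≤ Rθ) :
    ‖M.ψ θ‖ ≤ Rw := by
  rw [ψ, norm_neg, meanb_add_meanA hsolv]
  have h1 : ‖θ - M.θstar‖ ≤ 2 * Rθ := (norm_sub_le _ _).trans (by linarith)
  refine (M.invC.le_opNorm_of_le (M.meanA.le_opNorm_of_le h1)).trans (le_trans (le_of_eq ?_) hRw)
  ring

end OffPolicyProblem

/-! ### Young's inequality, projection onto a ball, direction functional -/

/-- Young's inequality for the square of a norm. -/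
theorem norm_add_sq_le_of_pos {H : Type*} [SeminormedAddCommGroup H] (x y : H) {s : ℝ} (hs : 0 < s) :
    ‖x + y‖ ^ 2 ≤ (1 + s) * ‖x‖ ^ 2 + (1 + 1 / s) * ‖y‖ ^ 2 := by
  have h1 : ‖x + y‖ ^ 2 ≤ (‖x‖ + ‖y‖) ^ 2 := by gcongr; exact norm_add_le _ _
  have h2 : 2 * ‖x‖ * ‖y‖ ≤ s * ‖x‖ ^ 2 + 1 / s * ‖y‖ ^ 2 := by
    have e : s * ‖x‖ ^ 2 + 1 / s * ‖y‖ ^ 2 - 2 * ‖x‖ * ‖y‖ = 1 / s * (s * ‖x‖ - ‖y‖) ^ 2 := by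
      field_simp; ring
    have : 0 ≤ 1 / s * (s * ‖x‖ - ‖y‖) ^ 2 := by positivity
    linarith
  nlinarith

section BallProj

variable {d : ℕ}

theorem norm_ballProj_sub_le {R : ℝ} {x : Param d} (hx : ‖x‖ ≤ R) (y : Param d) :
    ‖ballProj R y - x‖ ≤ ‖y - x‖ := by
  unfold ballProj
  split_ifs with h
  · exact le_rfl
  · have h' : R < ‖y‖ := lt_of_not_ge h
    have hR : 0 ≤ R := (norm_nonneg _).trans hx
    have hy : 0 < ‖y‖ := hR.trans_lt h'
    set c := R / ‖y‖ with hc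
    have hc1 : c ≤ 1 := (div_le_one hy).2 h'.le
    have hcy : c * ‖y‖ = R := div_mul_cancel₀ _ hy.ne'
    have h1 : inner ℝ y x ≤ c * ‖y‖ ^ 2 := by
      calc inner ℝ y x ≤ ‖y‖ * ‖x‖ := real_inner_le_norm _ _
        _ ≤ ‖y‖ * R := by gcongr
        _ = _ := by rw [← hcy]; ring
    have h2 : ‖c • y - x‖ ^ 2 ≤ ‖y - x‖ ^ 2 := by
      rw [norm_sub_sq_real, norm_sub_sq_real, norm_smul, inner_smul_left, RCLike.conj_to_real,
        mul_pow, Real.norm_eq_abs, sq_abs]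
      -- By `h1`, the difference of the two squares is at least `(1 - c) ^ 2 * ‖y‖ ^ 2`.
      nlinarith [mul_nonneg (sub_nonneg.2 hc1) (sub_nonneg.2 h1),
        mul_nonneg (sq_nonneg (1 - c)) (sq_nonneg ‖y‖)]
    exact le_of_sq_le_sq h2 (norm_nonneg _)

theorem measurable_ballProj (R : ℝ) : Measurable (ballProj R : Param d → Param d) := by
  unfold ballProj
  exact Measurable.ite (measurableSet_le measurable_norm measurable_const) measurable_id
    ((measurable_const.div measurable_norm).smul measurable_id)

end BallProj

section DirectionFunctional

variable {H : Type*} [NormedAddCommGroup H] [InnerProductSpace ℝ H]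

/-- The functional `(P, q, Q) ↦ ⟪P θ + q + Q w, z⟫`. -/
def dirFunctional (θ w z : H) : ((H →L[ℝ] H) × H × (H →L[ℝ] H)) →L[ℝ] ℝ :=
  (innerSL ℝ z) ∘L
    ((ContinuousLinearMap.apply ℝ H θ) ∘L ContinuousLinearMap.fst ℝ _ _
      + ContinuousLinearMap.fst ℝ _ _ ∘L ContinuousLinearMap.snd ℝ _ _
      + (ContinuousLinearMap.apply ℝ H w) ∘L
        ContinuousLinearMap.snd ℝ _ _ ∘L ContinuousLinearMap.snd ℝ _ _)

theorem dirFunctional_apply (θ w z : H) (p : (H →L[ℝ] H) × H × (H →L[ℝ] H)) :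
    dirFunctional θ w z p = inner ℝ z (p.1 θ + p.2.1 + p.2.2 w) := rfl

theorem norm_direction_le {θ w : H} {p : (H →L[ℝ] H) × H × (H →L[ℝ] H)} {B : ℝ}
    (h1 : ‖p.1‖ ≤ B) (h2 : ‖p.2.1‖ ≤ B) (h3 : ‖p.2.2‖ ≤ B) :
    ‖p.1 θ + p.2.1 + p.2.2 w‖ ≤ B * (‖θ‖ + 1 + ‖w‖) := by
  have e1 := p.1.le_of_opNorm_le h1 θ
  have e2 := p.2.2.le_of_opNorm_le h3 w
  refine (norm_add₃_le).trans ?_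
  linarith

theorem norm_dirFunctional_le (θ w z : H) :
    ‖dirFunctional θ w z‖ ≤ ‖z‖ * (‖θ‖ + 1 + ‖w‖) := by
  refine ContinuousLinearMap.opNorm_le_bound _ (by positivity) fun p => ?_
  rw [dirFunctional_apply, mul_assoc, mul_comm _ ‖p‖]
  refine (norm_inner_le_norm _ _).trans ?_
  gcongr
  exact norm_direction_le (norm_fst_le p) ((norm_fst_le p.2).trans (norm_snd_le p))
    ((norm_snd_le p.2).trans (norm_snd_le p))

/-- Supplies the increment bound `η` in `exists_noise_bound`: the functional moves no faster than
the iterates. -/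
theorem norm_dirFunctional_sub_le (θ w z θ' w' z' : H) :
    ‖dirFunctional θ w z - dirFunctional θ' w' z'‖
      ≤ ‖z‖ * (‖θ - θ'‖ + ‖w - w'‖) + ‖z - z'‖ * (‖θ'‖ + 1 + ‖w'‖) := by
  refine ContinuousLinearMap.opNorm_le_bound _ (by positivity) fun p => ?_
  have e : (dirFunctional θ w z - dirFunctional θ' w' z') p
      = inner ℝ z (p.1 (θ - θ') + p.2.2 (w - w')) + dirFunctional θ' w' (z - z') p := by
    simp only [sub_apply, dirFunctional_apply, map_sub, inner_sub_left, inner_add_right,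
      inner_sub_right]
    ring
  rw [e, add_mul]
  refine (norm_add_le _ _).trans (add_le_add ?_ ?_)
  · refine (norm_inner_le_norm _ _).trans ?_
    rw [mul_assoc]
    gcongr
    refine (norm_add_le _ _).trans ?_
    rw [add_mul, mul_comm _ ‖p‖, mul_comm _ ‖p‖]
    exact add_le_add (p.1.le_of_opNorm_le (norm_fst_le p) _)
      (p.2.2.le_of_opNorm_le ((norm_snd_le p.2).trans (norm_snd_le p)) _)
  · exact ContinuousLinearMap.le_of_opNorm_le _ (norm_dirFunctional_le _ _ _) _

theorem continuous_dirFunctional :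
    Continuous fun x : H × H × H => dirFunctional x.1 x.2.1 x.2.2 := by
  unfold dirFunctional
  have h1 : Continuous fun x : H × H × H => ContinuousLinearMap.apply ℝ H x.1 :=
    (ContinuousLinearMap.apply ℝ H).continuous.comp continuous_fst
  have h2 : Continuous fun x : H × H × H => ContinuousLinearMap.apply ℝ H x.2.1 :=
    (ContinuousLinearMap.apply ℝ H).continuous.comp (continuous_fst.comp continuous_snd)
  have h3 : Continuous fun x : H × H × H => innerSL ℝ x.2.2 :=
    (innerSL ℝ).continuous.comp (continuous_snd.comp continuous_snd)
  exact h3.clm_comp (((h1.clm_comp continuous_const).add continuous_const).add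
    (h2.clm_comp continuous_const))

theorem stronglyMeasurable_dirFunctional {X : Type*} {m : MeasurableSpace X} {θ w z : X → H}
    (hθ : StronglyMeasurable θ) (hw : StronglyMeasurable w) (hz : StronglyMeasurable z) :
    StronglyMeasurable fun x => dirFunctional (θ x) (w x) (z x) := by
  have h := hθ.prodMk (hw.prodMk hz)
  have h2 := Continuous.comp_stronglyMeasurable (continuous_dirFunctional (H := H)) h
  exact h2

end DirectionFunctional

/-! ### Bounds and measurability of the iterates -/

namespace OffPolicyProblem

variable {S A : Type*} [MeasurableSpace S] [MeasurableSpace A] {d : ℕ}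
  {M : OffPolicyProblem S A d} {Rθ Rw : ℝ} {α β : ℕ → ℝ} {θ0 w0 : Param d}

/-- Data of the fast update. -/
def fastObs (M : OffPolicyProblem S A d) (o : S × A × S) :
    (Param d →L[ℝ] Param d) × Param d × (Param d →L[ℝ] Param d) :=
  (M.matA o, M.vecb o, M.matC o)

/-- Data of the slow update. -/
def slowObs (M : OffPolicyProblem S A d) (o : S × A × S) :
    (Param d →L[ℝ] Param d) × Param d × (Param d →L[ℝ] Param d) :=
  (M.matA o, M.vecb o, M.matB o)

section Path

variable {o : ℕ → S × A × S}

/-- The initial point is arbitrary and enters the balls only after one projected update. All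
estimates therefore start at time `1`, which keeps the constants independent of `(θ0, w0)`. -/
theorem norm_tdc_le (h0 : 0 ≤ Rθ) (h0' : 0 ≤ Rw) {t : ℕ} (ht : 1 ≤ t) :
    ‖(M.tdc Rθ Rw α β θ0 w0 o t).1‖ ≤ Rθ ∧ ‖(M.tdc Rθ Rw α β θ0 w0 o t).2‖ ≤ Rw := by
  obtain ⟨t, rfl⟩ := Nat.exists_eq_add_of_le' ht
  exact ⟨(ballProj_isArgmin h0 _).1, (ballProj_isArgmin h0' _).1⟩

/-- Contraction of the slow update towards a point of the ball. -/
theorem norm_tdc_succ_fst_sub_le {x : Param d} (hx : ‖x‖ ≤ Rθ) (t : ℕ) :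
    ‖(M.tdc Rθ Rw α β θ0 w0 o (t + 1)).1 - x‖
      ≤ ‖(M.tdc Rθ Rw α β θ0 w0 o t).1 - x
        + α t • (M.matA (o t) (M.tdc Rθ Rw α β θ0 w0 o t).1 + M.vecb (o t)
          + M.matB (o t) (M.tdc Rθ Rw α β θ0 w0 o t).2)‖ := by
  rw [sub_add_eq_add_sub]
  exact norm_ballProj_sub_le hx _

/-- Contraction of the fast update towards a point of the ball. -/
theorem norm_tdc_succ_snd_sub_le {x : Param d} (hx : ‖x‖ ≤ Rw) (t : ℕ) :
    ‖(M.tdc Rθ Rw α β θ0 w0 o (t + 1)).2 - x‖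
      ≤ ‖(M.tdc Rθ Rw α β θ0 w0 o t).2 - x
        + β t • (M.matA (o t) (M.tdc Rθ Rw α β θ0 w0 o t).1 + M.vecb (o t)
          + M.matC (o t) (M.tdc Rθ Rw α β θ0 w0 o t).2)‖ := by
  rw [sub_add_eq_add_sub]
  exact norm_ballProj_sub_le hx _

variable {B : ℝ}

theorem norm_slow_direction_le
    (hB : ∀ o, ‖M.matA o‖ ≤ B ∧ ‖M.matB o‖ ≤ B ∧ ‖M.matC o‖ ≤ B ∧ ‖M.vecb o‖ ≤ B)
    (hB0 : 0 ≤ B) (h0 : 0 ≤ Rθ) (h0' : 0 ≤ Rw) {t : ℕ} (ht : 1 ≤ t) :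
    ‖M.matA (o t) (M.tdc Rθ Rw α β θ0 w0 o t).1 + M.vecb (o t)
      + M.matB (o t) (M.tdc Rθ Rw α β θ0 w0 o t).2‖ ≤ B * (Rθ + 1 + Rw) := by
  obtain ⟨h1, h2⟩ := norm_tdc_le (M := M) (α := α) (β := β) (θ0 := θ0) (w0 := w0) (o := o) h0 h0' ht
  refine (norm_direction_le (p := M.slowObs (o t)) (hB _).1 (hB _).2.2.2 (hB _).2.1).trans ?_
  gcongr

theorem norm_fast_direction_le
    (hB : ∀ o, ‖M.matA o‖ ≤ B ∧ ‖M.matB o‖ ≤ B ∧ ‖M.matC o‖ ≤ B ∧ ‖M.vecb o‖ ≤ B)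
    (hB0 : 0 ≤ B) (h0 : 0 ≤ Rθ) (h0' : 0 ≤ Rw) {t : ℕ} (ht : 1 ≤ t) :
    ‖M.matA (o t) (M.tdc Rθ Rw α β θ0 w0 o t).1 + M.vecb (o t)
      + M.matC (o t) (M.tdc Rθ Rw α β θ0 w0 o t).2‖ ≤ B * (Rθ + 1 + Rw) := by
  obtain ⟨h1, h2⟩ := norm_tdc_le (M := M) (α := α) (β := β) (θ0 := θ0) (w0 := w0) (o := o) h0 h0' ht
  refine (norm_direction_le (p := M.fastObs (o t)) (hB _).1 (hB _).2.2.2 (hB _).2.2.1).trans ?_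
  gcongr

theorem norm_tdc_succ_fst_sub_self_le
    (hB : ∀ o, ‖M.matA o‖ ≤ B ∧ ‖M.matB o‖ ≤ B ∧ ‖M.matC o‖ ≤ B ∧ ‖M.vecb o‖ ≤ B)
    (hB0 : 0 ≤ B) (h0 : 0 ≤ Rθ) (h0' : 0 ≤ Rw) {t : ℕ} (ht : 1 ≤ t)
    (hα : 0 ≤ α t) :
    ‖(M.tdc Rθ Rw α β θ0 w0 o (t + 1)).1 - (M.tdc Rθ Rw α β θ0 w0 o t).1‖
      ≤ α t * (B * (Rθ + 1 + Rw)) := by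
  refine (norm_tdc_succ_fst_sub_le (norm_tdc_le h0 h0' ht).1 t).trans ?_
  rw [sub_self, zero_add, norm_smul, Real.norm_of_nonneg hα]
  exact mul_le_mul_of_nonneg_left (norm_slow_direction_le hB hB0 h0 h0' ht) hα

theorem norm_tdc_succ_snd_sub_self_le
    (hB : ∀ o, ‖M.matA o‖ ≤ B ∧ ‖M.matB o‖ ≤ B ∧ ‖M.matC o‖ ≤ B ∧ ‖M.vecb o‖ ≤ B)
    (hB0 : 0 ≤ B) (h0 : 0 ≤ Rθ) (h0' : 0 ≤ Rw) {t : ℕ} (ht : 1 ≤ t)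
    (hβ : 0 ≤ β t) :
    ‖(M.tdc Rθ Rw α β θ0 w0 o (t + 1)).2 - (M.tdc Rθ Rw α β θ0 w0 o t).2‖
      ≤ β t * (B * (Rθ + 1 + Rw)) := by
  refine (norm_tdc_succ_snd_sub_le (norm_tdc_le h0 h0' ht).2 t).trans ?_
  rw [sub_self, zero_add, norm_smul, Real.norm_of_nonneg hβ]
  exact mul_le_mul_of_nonneg_left (norm_fast_direction_le hB hB0 h0 h0' ht) hβ

end Path

theorem continuous_ψ : Continuous M.ψ := by
  unfold ψ; fun_prop

section Measurability

variable [Finite A] [MeasurableSingletonClass A] {Ω : Type*} [mΩ : MeasurableSpace Ω]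
  {Pr : Measure Ω} {ℱ : Filtration ℕ mΩ} {s : ℕ → Ω → S} {a : ℕ → Ω → A}

theorem stronglyMeasurable_tdc (h : M.IsSamplePath Pr ℱ s a) (t : ℕ) :
    StronglyMeasurable[ℱ t] (fun ω =>
      M.tdc Rθ Rw α β θ0 w0 (fun i => (s i ω, a i ω, s (i + 1) ω)) t) := by
  induction t with
  | zero => exact stronglyMeasurable_const
  | succ t ih =>
    have ih' := ih.mono (ℱ.mono t.le_succ)
    have h1 := continuous_fst.comp_stronglyMeasurable ih'
    have h2 := continuous_snd.comp_stronglyMeasurable ih'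
    obtain ⟨hA, hBm, hb⟩ := stronglyMeasurable_obs (M := M)
    have hC := stronglyMeasurable_matC (M := M)
    have ho := h.measurable_obs t
    have happ : ∀ {G : S × A × S → Param d →L[ℝ] Param d} {x : Ω → Param d},
        StronglyMeasurable G → StronglyMeasurable[ℱ (t + 1)] x →
        StronglyMeasurable[ℱ (t + 1)] fun ω => G (s t ω, a t ω, s (t + 1) ω) (x ω) :=
      fun {G x} hG hx => isBoundedBilinearMap_apply.continuous.comp_stronglyMeasurable
        ((hG.comp_measurable ho).prodMk hx)
    have hproj : ∀ {R : ℝ} {x : Ω → Param d}, StronglyMeasurable[ℱ (t + 1)] x →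
        StronglyMeasurable[ℱ (t + 1)] fun ω => ballProj R (x ω) := fun {R x} hx =>
      ((measurable_ballProj R).comp hx.measurable).stronglyMeasurable
    exact (hproj (h1.add ((((happ hA h1).add (hb.comp_measurable ho)).add
        (happ hBm h2)).const_smul (α t)))).prodMk
      (hproj (h2.add ((((happ hA h1).add (hb.comp_measurable ho)).add
        (happ hC h2)).const_smul (β t))))

theorem stronglyMeasurable_fastObs : StronglyMeasurable M.fastObs := by
  obtain ⟨hA, hBm, hb⟩ := stronglyMeasurable_obs (M := M)
  exact hA.prodMk (hb.prodMk stronglyMeasurable_matC)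

theorem stronglyMeasurable_slowObs : StronglyMeasurable M.slowObs := by
  obtain ⟨hA, hBm, hb⟩ := stronglyMeasurable_obs (M := M)
  exact hA.prodMk (hb.prodMk hBm)

theorem integral_obs (hfeat : M.BoundedFeatures) :
    ∫ o, M.fastObs o ∂M.obsLaw = (M.meanA, M.meanb, M.meanC) ∧
      ∫ o, M.slowObs o ∂M.obsLaw = (M.meanA, M.meanb, M.meanB) := by
  obtain ⟨B, hB0, hB⟩ := exists_norm_le hfeat
  obtain ⟨hA, hBm, hb⟩ := stronglyMeasurable_obs (M := M)
  have hC := stronglyMeasurable_matC (M := M)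
  have iA : Integrable M.matA M.obsLaw :=
    .of_bound hA.aestronglyMeasurable B (ae_of_all _ fun o => (hB o).1)
  have iB : Integrable M.matB M.obsLaw :=
    .of_bound hBm.aestronglyMeasurable B (ae_of_all _ fun o => (hB o).2.1)
  have iC : Integrable M.matC M.obsLaw :=
    .of_bound hC.aestronglyMeasurable B (ae_of_all _ fun o => (hB o).2.2.1)
  have ib : Integrable M.vecb M.obsLaw :=
    .of_bound hb.aestronglyMeasurable B (ae_of_all _ fun o => (hB o).2.2.2)
  constructor
  · unfold fastObs
    rw [integral_pair iA (ib.prodMk iC), integral_pair ib iC]; rfl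
  · unfold slowObs
    rw [integral_pair iA (ib.prodMk iB), integral_pair ib iB]; rfl

end Measurability

end OffPolicyProblem

/-! ### Comparison of the two stepsizes -/

section StepRatio

theorem polyStep_eq_mul {cα cβ σ ν : ℝ} (hβ : 0 < cβ) (t : ℕ) :
    polyStep cα σ t = cα / cβ * polyStep cβ ν t * (1 + t : ℝ) ^ (-(σ - ν)) := by
  have h1 : (0 : ℝ) < 1 + t := by positivity
  have h2 := Real.rpow_pos_of_pos h1 ν
  have h3 := Real.rpow_pos_of_pos h1 σ
  rw [polyStep, polyStep, neg_sub, Real.rpow_sub h1]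
  field_simp

theorem polyStep_le_mul_polyStep {cα cβ σ ν : ℝ} (hα : 0 < cα) (hβ : 0 < cβ) (h : ν ≤ σ) (t : ℕ) :
    polyStep cα σ t ≤ cα / cβ * polyStep cβ ν t := by
  have := polyStep_pos (p := ν) hβ t
  rw [polyStep_eq_mul (ν := ν) hβ]
  refine mul_le_of_le_one_right (by positivity) (Real.rpow_le_one_of_one_le_of_nonpos ?_ ?_)
  · simp
  · linarith

/-- Bounds the forcing `α ^ 2 / β = β * (α / β) ^ 2` caused by the moving target `ψ θ_t`. Its
exponent relative to `β` is `2 * (σ - ν)`. -/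
theorem polyStep_sq_le {cα cβ σ ν δ : ℝ} (hβ : 0 < cβ) (hδ : 0 ≤ δ)
    (hδσ : δ ≤ 2 * (σ - ν)) {t : ℕ} (ht : 1 ≤ t) :
    polyStep cα σ t ^ 2 ≤ (cα / cβ) ^ 2 * polyStep cβ ν t ^ 2 * (t : ℝ) ^ (-δ) := by
  have h1 : (1 : ℝ) ≤ t := by exact_mod_cast ht
  have h2 : (0 : ℝ) < 1 + t := by linarith
  rw [polyStep_eq_mul (ν := ν) hβ, mul_pow, mul_pow]
  refine mul_le_mul_of_nonneg_left ?_ (by positivity)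
  rw [← Real.rpow_natCast, ← Real.rpow_mul h2.le]
  calc (1 + t : ℝ) ^ (-(σ - ν) * (2 : ℕ)) ≤ (1 + t : ℝ) ^ (-δ) :=
        Real.rpow_le_rpow_of_exponent_le (by linarith) (by push_cast; linarith)
    _ ≤ (t : ℝ) ^ (-δ) := Real.rpow_le_rpow_of_nonpos (by linarith) (by linarith) (by linarith)

end StepRatio

/-! ### One-step inequalities -/

namespace OffPolicyProblem

variable {S A : Type*} [MeasurableSpace S] [MeasurableSpace A] {d : ℕ}
  {M : OffPolicyProblem S A d} {Rθ Rw : ℝ} {α β : ℕ → ℝ} {θ0 w0 : Param d}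

section OneStep

variable {o : ℕ → S × A × S} {B : ℝ}

/-- One-step inequality for the tracking error. -/
theorem sq_norm_tracking_succ_le (hsolv : M.Solvable) (hRθ : ‖M.θstar‖ ≤ Rθ)
    (hRw : 2 * ‖M.invC‖ * ‖M.meanA‖ * Rθ ≤ Rw)
    (hB : ∀ o, ‖M.matA o‖ ≤ B ∧ ‖M.matB o‖ ≤ B ∧ ‖M.matC o‖ ≤ B ∧ ‖M.vecb o‖ ≤ B)
    (hB0 : 0 ≤ B) (h0 : 0 ≤ Rθ) (h0' : 0 ≤ Rw) {t : ℕ} (ht : 1 ≤ t) (hα : 0 ≤ α t) (hβ : 0 < β t)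
    {η : ℝ} (hη : 0 < η) {θ w θ' w' : Param d} (hx : M.tdc Rθ Rw α β θ0 w0 o t = (θ, w))
    (hx' : M.tdc Rθ Rw α β θ0 w0 o (t + 1) = (θ', w')) :
    ‖w' - M.ψ θ'‖ ^ 2 ≤ (1 + 2 * η * β t) * ‖w - M.ψ θ‖ ^ 2
      + 2 * β t * dirFunctional θ w (w - M.ψ θ) (M.fastObs (o t))
      + (1 + 2 * η * β t) * (β t * (B * (Rθ + 1 + Rw))) ^ 2
      + (1 + 1 / (η * β t)) * (‖M.invC‖ * ‖M.meanA‖ * (α t * (B * (Rθ + 1 + Rw)))) ^ 2 := by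
  set G := B * (Rθ + 1 + Rw) with hG
  have hθ := (norm_tdc_le (M := M) (α := α) (β := β) (θ0 := θ0) (w0 := w0) (o := o) h0 h0' ht).1
  have h1 := norm_tdc_succ_snd_sub_le (M := M) (Rθ := Rθ) (α := α) (β := β) (θ0 := θ0) (w0 := w0) (o := o)
    (norm_ψ_le hsolv hRθ hRw hθ) t
  have h2 := norm_fast_direction_le (α := α) (β := β) (θ0 := θ0) (w0 := w0) (o := o)
    hB hB0 h0 h0' ht
  have h3 := norm_tdc_succ_fst_sub_self_le (β := β) (θ0 := θ0) (w0 := w0) (o := o)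
    hB hB0 h0 h0' ht hα
  simp only [hx, hx'] at h1 h2 h3
  set z := w - M.ψ θ with hz
  set g := M.matA (o t) θ + M.vecb (o t) + M.matC (o t) w with hg
  have hdir : dirFunctional θ w z (M.fastObs (o t)) = inner ℝ z g := rfl
  rw [hdir]
  -- The projected step is compared with the old target `ψ θ`; the displacement of the target is a
  -- separate perturbation.
  have e : w' - M.ψ θ' = (w' - M.ψ θ) + (M.ψ θ - M.ψ θ') := by abel
  have h4 : ‖M.ψ θ - M.ψ θ'‖ ≤ ‖M.invC‖ * ‖M.meanA‖ * (α t * G) := by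
    refine (norm_ψ_sub_ψ_le θ θ').trans ?_
    rw [norm_sub_rev]
    gcongr
  have h5 : ‖z + β t • g‖ ^ 2 ≤ ‖z‖ ^ 2 + 2 * β t * inner ℝ z g + (β t * G) ^ 2 := by
    rw [norm_add_sq_real, inner_smul_right, norm_smul, Real.norm_of_nonneg hβ.le]
    have : (β t * ‖g‖) ^ 2 ≤ (β t * G) ^ 2 := by gcongr
    linarith
  have h6 : ‖z + β t • g‖ ^ 2 ≤ 2 * ‖z‖ ^ 2 + 2 * (β t * G) ^ 2 := by
    have := norm_add_sq_le_of_pos z (β t • g) one_pos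
    rw [norm_smul, Real.norm_of_nonneg hβ.le] at this
    have : (β t * ‖g‖) ^ 2 ≤ (β t * G) ^ 2 := by gcongr
    linarith
  have h7 : ‖w' - M.ψ θ‖ ^ 2 ≤ ‖z + β t • g‖ ^ 2 := by gcongr
  have h8 : ‖M.ψ θ - M.ψ θ'‖ ^ 2 ≤ (‖M.invC‖ * ‖M.meanA‖ * (α t * G)) ^ 2 := by gcongr
  -- Young's parameter `η * β t` is proportional to the fast step: it spends only a fraction of the
  -- contraction, at the price of the factor `1 / (η * β t)` on the squared target displacement.
  have h9 := norm_add_sq_le_of_pos (w' - M.ψ θ) (M.ψ θ - M.ψ θ') (mul_pos hη hβ)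
  rw [e]
  refine h9.trans ?_
  have h10 : (1 + 1 / (η * β t)) * ‖M.ψ θ - M.ψ θ'‖ ^ 2
      ≤ (1 + 1 / (η * β t)) * (‖M.invC‖ * ‖M.meanA‖ * (α t * G)) ^ 2 :=
    mul_le_mul_of_nonneg_left h8 (by positivity)
  have h11 : (1 + η * β t) * ‖w' - M.ψ θ‖ ^ 2
      ≤ (‖z‖ ^ 2 + 2 * β t * inner ℝ z g + (β t * G) ^ 2)
        + η * β t * (2 * ‖z‖ ^ 2 + 2 * (β t * G) ^ 2) := by
    rw [add_mul, one_mul]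
    exact add_le_add (h7.trans h5) (mul_le_mul_of_nonneg_left (h7.trans h6) (by positivity))
  linarith

/-- One-step inequality for the training error. -/
theorem sq_norm_training_succ_le (hRθ : ‖M.θstar‖ ≤ Rθ)
    (hB : ∀ o, ‖M.matA o‖ ≤ B ∧ ‖M.matB o‖ ≤ B ∧ ‖M.matC o‖ ≤ B ∧ ‖M.vecb o‖ ≤ B)
    (hB0 : 0 ≤ B) (h0 : 0 ≤ Rθ) (h0' : 0 ≤ Rw) {t : ℕ} (ht : 1 ≤ t) (hα : 0 ≤ α t)
    {θ w θ' w' : Param d} (hx : M.tdc Rθ Rw α β θ0 w0 o t = (θ, w))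
    (hx' : M.tdc Rθ Rw α β θ0 w0 o (t + 1) = (θ', w')) :
    ‖θ' - M.θstar‖ ^ 2 ≤ ‖θ - M.θstar‖ ^ 2
      + 2 * α t * dirFunctional θ w (θ - M.θstar) (M.slowObs (o t))
      + (α t * (B * (Rθ + 1 + Rw))) ^ 2 := by
  set G := B * (Rθ + 1 + Rw) with hG
  have h1 := norm_tdc_succ_fst_sub_le (M := M) (α := α) (β := β) (Rw := Rw) (θ0 := θ0) (w0 := w0)
    (o := o) hRθ t
  have h2 := norm_slow_direction_le (α := α) (β := β) (θ0 := θ0) (w0 := w0) (o := o)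
    hB hB0 h0 h0' ht
  simp only [hx, hx'] at h1 h2
  set f := M.matA (o t) θ + M.vecb (o t) + M.matB (o t) w with hf
  have hdir : dirFunctional θ w (θ - M.θstar) (M.slowObs (o t)) = inner ℝ (θ - M.θstar) f := rfl
  rw [hdir]
  have h5 : ‖θ - M.θstar + α t • f‖ ^ 2
      ≤ ‖θ - M.θstar‖ ^ 2 + 2 * α t * inner ℝ (θ - M.θstar) f + (α t * G) ^ 2 := by
    rw [norm_add_sq_real, inner_smul_right, norm_smul, Real.norm_of_nonneg hα]
    have : (α t * ‖f‖) ^ 2 ≤ (α t * G) ^ 2 := by gcongr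
    linarith
  exact le_trans (by gcongr) h5

end OneStep

/-- Drift of the tracking error along the mean direction. -/
theorem dirFunctional_fast_mean_le (hsolv : M.Solvable) (hfeat : M.BoundedFeatures) {lw : ℝ}
    (hlw : M.FastRate lw) (θ w : Param d) :
    2 * dirFunctional θ w (w - M.ψ θ) (M.meanA, M.meanb, M.meanC) ≤ lw * ‖w - M.ψ θ‖ ^ 2 := by
  rw [dirFunctional_apply, mean_fast hsolv, real_inner_comm]
  exact inner_meanC_le hfeat hlw _

/-- Drift of the training error along the mean direction. -/
theorem dirFunctional_slow_mean_le [Finite A] [MeasurableSingletonClass A] (hsolv : M.Solvable)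
    (hfeat : M.BoundedFeatures) {lθ : ℝ} (hlθ : M.SlowRate lθ) (θ w : Param d) :
    2 * dirFunctional θ w (θ - M.θstar) (M.meanA, M.meanb, M.meanB)
      ≤ 5 / 6 * lθ * ‖θ - M.θstar‖ ^ 2 + 6 * ‖M.meanB‖ ^ 2 / (-lθ) * ‖w - M.ψ θ‖ ^ 2 := by
  rw [dirFunctional_apply, mean_slow hsolv hfeat, inner_add_right, real_inner_comm]
  have h1 := inner_slow_le hsolv hfeat hlθ (θ - M.θstar)
  set e := θ - M.θstar
  set z := w - M.ψ θ
  have hl : 0 < -lθ := neg_pos.2 hlθ.1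
  have h2 : inner ℝ e (M.meanB z) ≤ ‖e‖ * (‖M.meanB‖ * ‖z‖) :=
    (real_inner_le_norm _ _).trans (by gcongr; exact M.meanB.le_opNorm _)
  -- The weights spend only a sixth of the contraction on the coupling with `z`. The remaining `5 /
  -- 6` exceeds the exponent `2 / 3` needed when `σ = 1` and `cα = 1 / |lθ|`.
  have h3 : 2 * (‖e‖ * (‖M.meanB‖ * ‖z‖))
      ≤ -lθ / 6 * ‖e‖ ^ 2 + 6 * ‖M.meanB‖ ^ 2 / (-lθ) * ‖z‖ ^ 2 := by
    have h4 : -lθ / 6 * ‖e‖ ^ 2 + 6 * ‖M.meanB‖ ^ 2 / (-lθ) * ‖z‖ ^ 2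
        - 2 * (‖e‖ * (‖M.meanB‖ * ‖z‖))
        = 1 / (6 * -lθ) * (-lθ * ‖e‖ - 6 * (‖M.meanB‖ * ‖z‖)) ^ 2 := by
      have := hlθ.1.ne
      field_simp; ring
    have : 0 ≤ 1 / (6 * -lθ) * (-lθ * ‖e‖ - 6 * (‖M.meanB‖ * ‖z‖)) ^ 2 := by positivity
    linarith
  linarith

end OffPolicyProblem

/-! ### Rate of the tracking error -/

namespace OffPolicyProblem

variable {S A : Type*} [MeasurableSpace S] [MeasurableSpace A] {d : ℕ}
  {M : OffPolicyProblem S A d} {Rθ Rw : ℝ} {α β : ℕ → ℝ} {θ0 w0 : Param d}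

theorem norm_training_le (hRθ : ‖M.θstar‖ ≤ Rθ) (h0' : 0 ≤ Rw) {t : ℕ} (ht : 1 ≤ t)
    (o : ℕ → S × A × S) :
    ‖(M.tdc Rθ Rw α β θ0 w0 o t).1 - M.θstar‖ ≤ 2 * Rθ := by
  have h1 := (norm_tdc_le (M := M) (α := α) (β := β) (θ0 := θ0) (w0 := w0) (o := o)
    ((norm_nonneg _).trans hRθ) h0' ht).1
  exact (norm_sub_le _ _).trans (by linarith)

theorem norm_tracking_le (hsolv : M.Solvable) (hRθ : ‖M.θstar‖ ≤ Rθ)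
    (hRw : 2 * ‖M.invC‖ * ‖M.meanA‖ * Rθ ≤ Rw) (h0' : 0 ≤ Rw) {t : ℕ} (ht : 1 ≤ t)
    (o : ℕ → S × A × S) :
    ‖(M.tdc Rθ Rw α β θ0 w0 o t).2 - M.ψ (M.tdc Rθ Rw α β θ0 w0 o t).1‖ ≤ 2 * Rw := by
  obtain ⟨h1, h2⟩ := norm_tdc_le (M := M) (α := α) (β := β) (θ0 := θ0) (w0 := w0) (o := o)
    ((norm_nonneg _).trans hRθ) h0' ht
  have h3 := norm_ψ_le hsolv hRθ hRw h1
  exact (norm_sub_le _ _).trans (by linarith)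

theorem norm_obs_le {B : ℝ}
    (hB : ∀ o, ‖M.matA o‖ ≤ B ∧ ‖M.matB o‖ ≤ B ∧ ‖M.matC o‖ ≤ B ∧ ‖M.vecb o‖ ≤ B)
    (o : S × A × S) : ‖M.fastObs o‖ ≤ B ∧ ‖M.slowObs o‖ ≤ B :=
  ⟨norm_prod_le_iff.2 ⟨(hB o).1, norm_prod_le_iff.2 ⟨(hB o).2.2.2, (hB o).2.2.1⟩⟩,
    norm_prod_le_iff.2 ⟨(hB o).1, norm_prod_le_iff.2 ⟨(hB o).2.2.2, (hB o).2.1⟩⟩⟩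

variable [Finite A] [MeasurableSingletonClass A]

section Integrability

variable {Ω : Type*} [mΩ : MeasurableSpace Ω] {Pr : Measure Ω} {ℱ : Filtration ℕ mΩ}
  {s : ℕ → Ω → S} {a : ℕ → Ω → A}

theorem stronglyMeasurable_training (h : M.IsSamplePath Pr ℱ s a) (t : ℕ) :
    StronglyMeasurable[ℱ t] fun ω =>
      (M.tdc Rθ Rw α β θ0 w0 (fun i => (s i ω, a i ω, s (i + 1) ω)) t).1 - M.θstar :=
  (continuous_fst.comp_stronglyMeasurable (stronglyMeasurable_tdc h t)).sub
    stronglyMeasurable_const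

theorem stronglyMeasurable_tracking (h : M.IsSamplePath Pr ℱ s a) (t : ℕ) :
    StronglyMeasurable[ℱ t] fun ω =>
      (M.tdc Rθ Rw α β θ0 w0 (fun i => (s i ω, a i ω, s (i + 1) ω)) t).2
        - M.ψ (M.tdc Rθ Rw α β θ0 w0 (fun i => (s i ω, a i ω, s (i + 1) ω)) t).1 :=
  (continuous_snd.comp_stronglyMeasurable (stronglyMeasurable_tdc h t)).sub
    ((continuous_ψ.comp continuous_fst).comp_stronglyMeasurable (stronglyMeasurable_tdc h t))

theorem integrable_trainErr [IsProbabilityMeasure Pr] (h : M.IsSamplePath Pr ℱ s a)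
    (hRθ : ‖M.θstar‖ ≤ Rθ) (h0' : 0 ≤ Rw) {t : ℕ} (ht : 1 ≤ t) :
    Integrable (M.trainErr Rθ Rw α β θ0 w0 s a t) Pr := by
  refine Integrable.of_bound (C := (2 * Rθ) ^ 2) ?_ (ae_of_all _ fun ω => ?_)
  · exact ((((stronglyMeasurable_training h t).mono (ℱ.le t)).norm).pow 2).aestronglyMeasurable
  · rw [trainErr, norm_pow, norm_norm]
    gcongr
    exact norm_training_le hRθ h0' ht _

theorem integrable_trackErr [IsProbabilityMeasure Pr] (h : M.IsSamplePath Pr ℱ s a)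
    (hsolv : M.Solvable) (hRθ : ‖M.θstar‖ ≤ Rθ)
    (hRw : 2 * ‖M.invC‖ * ‖M.meanA‖ * Rθ ≤ Rw) (h0' : 0 ≤ Rw) {t : ℕ} (ht : 1 ≤ t) :
    Integrable (M.trackErr Rθ Rw α β θ0 w0 s a t) Pr := by
  refine Integrable.of_bound (C := (2 * Rw) ^ 2) ?_ (ae_of_all _ fun ω => ?_)
  · exact ((((stronglyMeasurable_tracking h t).mono (ℱ.le t)).norm).pow 2).aestronglyMeasurable
  · rw [trackErr, norm_pow, norm_norm]
    gcongr
    exact norm_tracking_le hsolv hRθ hRw h0' ht _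

theorem integrable_dirFunctional [IsProbabilityMeasure Pr] (h : M.IsSamplePath Pr ℱ s a)
    (hRθ : ‖M.θstar‖ ≤ Rθ) (h0' : 0 ≤ Rw) {t : ℕ} (ht : 1 ≤ t)
    {z : Ω → Param d} (hz : StronglyMeasurable[ℱ t] z) {Z : ℝ} (hZ : ∀ ω, ‖z ω‖ ≤ Z)
    {g : S × A × S → (Param d →L[ℝ] Param d) × Param d × (Param d →L[ℝ] Param d)}
    (hg : StronglyMeasurable g) {B : ℝ} (hB : ∀ o, ‖g o‖ ≤ B)
    (c : (Param d →L[ℝ] Param d) × Param d × (Param d →L[ℝ] Param d)) :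
    Integrable (fun ω => dirFunctional
      (M.tdc Rθ Rw α β θ0 w0 (fun i => (s i ω, a i ω, s (i + 1) ω)) t).1
      (M.tdc Rθ Rw α β θ0 w0 (fun i => (s i ω, a i ω, s (i + 1) ω)) t).2 (z ω)
      (g (s t ω, a t ω, s (t + 1) ω) - c)) Pr := by
  have hX := (stronglyMeasurable_tdc (M := M) (Rθ := Rθ) (Rw := Rw) (α := α) (β := β) (θ0 := θ0)
    (w0 := w0) h t).mono (ℱ.le t)
  have ho : Measurable fun ω => (s t ω, a t ω, s (t + 1) ω) :=
    (h.measurable_obs t).mono (ℱ.le _) le_rfl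
  have hX1 := continuous_fst.comp_stronglyMeasurable hX
  have hX2 := continuous_snd.comp_stronglyMeasurable hX
  have hY := stronglyMeasurable_dirFunctional hX1 hX2 (hz.mono (ℱ.le t))
  refine Integrable.of_bound (C := Z * (Rθ + 1 + Rw) * (B + ‖c‖)) ?_ (ae_of_all _ fun ω => ?_)
  · exact (isBoundedBilinearMap_apply.continuous.comp_stronglyMeasurable
      (hY.prodMk ((hg.comp_measurable ho).sub stronglyMeasurable_const))).aestronglyMeasurable
  · obtain ⟨h1, h2⟩ := norm_tdc_le (M := M) (α := α) (β := β) (θ0 := θ0) (w0 := w0)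
      (o := fun i => (s i ω, a i ω, s (i + 1) ω)) ((norm_nonneg _).trans hRθ) h0' ht
    have hZ0 : 0 ≤ Z := (norm_nonneg _).trans (hZ ω)
    refine ContinuousLinearMap.le_of_opNorm_le_of_le _
      ((norm_dirFunctional_le _ _ _).trans ?_) ((norm_sub_le _ _).trans ?_)
    · gcongr
      exact hZ ω
    · gcongr
      exact hB _

end Integrability

set_option maxHeartbeats 400000 in
/-- Mean-square rate of the tracking error. -/
theorem exists_integral_trackErr_le (hsolv : M.Solvable) (hfeat : M.BoundedFeatures)
    (herg : M.GeometricallyErgodic) (hRθ : ‖M.θstar‖ ≤ Rθ)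
    (hRw : 2 * ‖M.invC‖ * ‖M.meanA‖ * Rθ ≤ Rw) {lw : ℝ} (hlw : M.FastRate lw)
    {σ ν cα cβ δ : ℝ} (hα : 0 < cα) (hβ : 0 < cβ) (hν : 0 < ν) (hν1 : ν < 1) (hνσ : ν < σ)
    (hδ : 0 ≤ δ) (hδν : δ ≤ ν) (hδσ : δ ≤ 2 * (σ - ν)) :
    ∃ K : ℝ, 0 ≤ K ∧ ∀ (Ω : Type*) [mΩ : MeasurableSpace Ω] (Pr : Measure Ω)
      [IsProbabilityMeasure Pr] (ℱ : Filtration ℕ mΩ) (s : ℕ → Ω → S) (a : ℕ → Ω → A),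
      M.IsSamplePath Pr ℱ s a → ∀ (θ0 w0 : Param d) (t : ℕ), 1 ≤ t →
        ∫ ω, M.trackErr Rθ Rw (polyStep cα σ) (polyStep cβ ν) θ0 w0 s a t ω ∂Pr
          ≤ K * (t : ℝ) ^ (-δ) := by
  obtain ⟨B, hB0, hB⟩ := exists_norm_le hfeat
  have h0 : 0 ≤ Rθ := (norm_nonneg _).trans hRθ
  have h0' : 0 ≤ Rw := le_trans (by positivity) hRw
  obtain ⟨Cn, hCn0, hCn⟩ := exists_noise_bound herg (stronglyMeasurable_fastObs (M := M))
    (fun o => (norm_obs_le hB o).1)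
  have hl : lw < 0 := hlw.1
  set G := B * (Rθ + 1 + Rw) with hG
  have hG0 : 0 ≤ G := by positivity
  set r := cα / cβ with hr
  have hr0 : 0 < r := by positivity
  set L := ‖M.invC‖ * ‖M.meanA‖ with hL
  have hL0 : 0 ≤ L := by positivity
  -- Increment of the direction functional per unit of the fast step; slow increments are converted
  -- by `α ≤ r * β`.
  set I := 2 * Rw * (r * G + G) + (G + L * (r * G)) * (Rθ + 1 + Rw) with hI
  have hI0 : 0 ≤ I := by positivity
  -- The mean drift contracts by `4 * η * β` and Young's inequality gives back `2 * η * β`, leaving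
  -- the rate `b = 2 * η`.
  obtain ⟨η, hη, hηl⟩ : ∃ η : ℝ, 0 < η ∧ lw = -(4 * η) := ⟨-lw / 4, by linarith, by ring⟩
  set U := (2 * Rw) ^ 2 + 2 * (2 * Rw * (Rθ + 1 + Rw) * Cn) with hU
  have hBYC : 0 ≤ 2 * Rw * (Rθ + 1 + Rw) * Cn := by positivity
  -- In order: noise increments, the squared fast update, and the moving target. The first two are
  -- of order `β ^ 2` and use `δ ≤ ν`; the last uses `δ ≤ 2 * (σ - ν)`.
  set C := 2 * I * Cn * cβ + (1 + 2 * η * cβ) * G ^ 2 * cβ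
    + (cβ + 1 / η) * (L * G * r) ^ 2 with hC
  obtain ⟨K, hK0, hK⟩ := chung_telescoping (c := cβ) (p := ν) (b := 2 * η) (δ := δ) (C := C)
    (U := U) hβ hν hν1.le (by positivity) (by positivity) (by positivity) hδ hδν (Or.inl hν1)
  refine ⟨K, hK0, ?_⟩
  intro Ω mΩ Pr _ ℱ s a h θ0 w0
  set X : ℕ → Ω → Param d × Param d := fun t ω =>
    M.tdc Rθ Rw (polyStep cα σ) (polyStep cβ ν) θ0 w0 (fun i => (s i ω, a i ω, s (i + 1) ω)) t
    with hX
  have hXm : ∀ t, StronglyMeasurable[ℱ t] (X t) := fun t => stronglyMeasurable_tdc h t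
  have hzm : ∀ t, StronglyMeasurable[ℱ t] fun ω => (X t ω).2 - M.ψ (X t ω).1 :=
    fun t => stronglyMeasurable_tracking h t
  have hαs : ∀ t, 0 < polyStep cα σ t := polyStep_pos hα
  have hβs : ∀ t, 0 < polyStep cβ ν t := polyStep_pos hβ
  have hαβ : ∀ t, polyStep cα σ t ≤ r * polyStep cβ ν t :=
    polyStep_le_mul_polyStep hα hβ hνσ.le
  have hzb : ∀ t, 1 ≤ t → ∀ ω, ‖(X t ω).2 - M.ψ (X t ω).1‖ ≤ 2 * Rw :=
    fun t ht ω => norm_tracking_le hsolv hRθ hRw h0' ht _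
  have hXb : ∀ t, 1 ≤ t → ∀ ω, ‖(X t ω).1‖ ≤ Rθ ∧ ‖(X t ω).2‖ ≤ Rw :=
    fun t ht ω => norm_tdc_le h0 h0' ht
  have hYm : ∀ t, StronglyMeasurable[ℱ t] fun ω =>
      dirFunctional (X t ω).1 (X t ω).2 ((X t ω).2 - M.ψ (X t ω).1) := by
    intro t
    have hX1 := continuous_fst.comp_stronglyMeasurable (hXm t)
    have hX2 := continuous_snd.comp_stronglyMeasurable (hXm t)
    exact stronglyMeasurable_dirFunctional hX1 hX2 (hzm t)
  obtain ⟨D, hDb, hD⟩ := hCn Ω Pr ℱ s a h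
    (fun t ω => dirFunctional (X t ω).1 (X t ω).2 ((X t ω).2 - M.ψ (X t ω).1))
    (2 * Rw * (Rθ + 1 + Rw))
    hYm
    (fun t ht ω => by
      obtain ⟨h1, h2⟩ := hXb t ht ω
      refine (norm_dirFunctional_le _ _ _).trans ?_
      have := hzb t ht ω
      gcongr)
  refine hK (fun t => ∫ ω, M.trackErr Rθ Rw (polyStep cα σ) (polyStep cβ ν) θ0 w0 s a t ω ∂Pr)
    (fun t => 2 * D t) (fun t ht => ?_) (fun t ht => ?_) (fun t ht => ?_)
  · refine (Real.le_norm_self _).trans ((norm_integral_le_of_norm_le_const (C := (2 * Rw) ^ 2)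
      (ae_of_all _ fun ω => ?_)).trans ?_)
    · rw [trackErr, norm_pow, norm_norm]
      gcongr
      exact hzb t ht ω
    · simp only [probReal_univ, mul_one]
      linarith
  · rw [abs_mul, abs_two]
    nlinarith [hDb t ht, sq_nonneg (2 * Rw)]
  · set at_ := polyStep cα σ t with hat
    set bt := polyStep cβ ν t with hbt
    have hat0 : 0 < at_ := hαs t
    have hbt0 : 0 < bt := hβs t
    have hab : at_ ≤ r * bt := hαβ t
    have hx0 : 0 ≤ (t : ℝ) ^ (-δ) := Real.rpow_nonneg (Nat.cast_nonneg t) _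
    have hbx : bt ≤ cβ * (t : ℝ) ^ (-δ) := polyStep_le_mul_rpow hβ hδ hδν ht
    have hbc : bt ≤ cβ := polyStep_le hβ hν.le t
    have hasq : at_ ^ 2 ≤ r ^ 2 * bt ^ 2 * (t : ℝ) ^ (-δ) := polyStep_sq_le hβ hδ hδσ ht
    have hnoise := hD t ht (bt * I) (fun ω => by
      have h1 : ‖(X (t + 1) ω).1 - (X t ω).1‖ ≤ at_ * G :=
        norm_tdc_succ_fst_sub_self_le hB hB0 h0 h0' ht hat0.le
      have h2 : ‖(X (t + 1) ω).2 - (X t ω).2‖ ≤ bt * G :=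
        norm_tdc_succ_snd_sub_self_le hB hB0 h0 h0' ht hbt0.le
      have h3 : ‖M.ψ (X (t + 1) ω).1 - M.ψ (X t ω).1‖ ≤ L * (at_ * G) :=
        (norm_ψ_sub_ψ_le _ _).trans (by gcongr)
      have h4 : ‖(X (t + 1) ω).2 - M.ψ (X (t + 1) ω).1 - ((X t ω).2 - M.ψ (X t ω).1)‖
          ≤ bt * G + L * (at_ * G) := by
        rw [sub_sub_sub_comm]
        exact (norm_sub_le _ _).trans (add_le_add h2 h3)
      have h5 := hzb (t + 1) (by omega) ω
      obtain ⟨h6, h7⟩ := hXb t ht ω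
      refine (norm_dirFunctional_sub_le _ _ _ _ _ _).trans ?_
      calc _ ≤ 2 * Rw * (at_ * G + bt * G)
            + (bt * G + L * (at_ * G)) * (Rθ + 1 + Rw) := by gcongr
        _ ≤ 2 * Rw * (r * bt * G + bt * G)
            + (bt * G + L * (r * bt * G)) * (Rθ + 1 + Rw) := by gcongr
        _ = bt * I := by rw [hI]; ring)
    rw [(integral_obs hfeat).1] at hnoise
    have hNint := integrable_dirFunctional (α := polyStep cα σ) (β := polyStep cβ ν) (θ0 := θ0)
      (w0 := w0) h hRθ h0' ht (hzm t) (hzb t ht)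
      (stronglyMeasurable_fastObs (M := M)) (fun o => (norm_obs_le hB o).1)
      (M.meanA, M.meanb, M.meanC)
    have hu := integrable_trackErr (α := polyStep cα σ) (β := polyStep cβ ν) (θ0 := θ0)
      (w0 := w0) h hsolv hRθ hRw h0' ht
    have hu' := integrable_trackErr (α := polyStep cα σ) (β := polyStep cβ ν) (θ0 := θ0)
      (w0 := w0) h hsolv hRθ hRw h0' (t := t + 1) (by omega)
    set N : Ω → ℝ := fun ω => dirFunctional (X t ω).1 (X t ω).2 ((X t ω).2 - M.ψ (X t ω).1)
      (M.fastObs (s t ω, a t ω, s (t + 1) ω) - (M.meanA, M.meanb, M.meanC)) with hN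
    set Q := (1 + 2 * η * bt) * (bt * G) ^ 2 + (1 + 1 / (η * bt)) * (L * (at_ * G)) ^ 2 with hQ
    have hpt : ∀ ω, M.trackErr Rθ Rw (polyStep cα σ) (polyStep cβ ν) θ0 w0 s a (t + 1) ω
        ≤ (1 - 2 * η * bt) * M.trackErr Rθ Rw (polyStep cα σ) (polyStep cβ ν) θ0 w0 s a t ω
          + 2 * bt * N ω + Q := by
      intro ω
      have h1 := sq_norm_tracking_succ_le (α := polyStep cα σ) (β := polyStep cβ ν) (θ0 := θ0)
        (w0 := w0) (o := fun i => (s i ω, a i ω, s (i + 1) ω)) hsolv hRθ hRw hB hB0 h0 h0' ht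
        hat0.le hbt0 hη (θ := (X t ω).1) (w := (X t ω).2) (θ' := (X (t + 1) ω).1)
        (w' := (X (t + 1) ω).2) rfl rfl
      have h2 := dirFunctional_fast_mean_le hsolv hfeat hlw (X t ω).1 (X t ω).2
      have h3 : N ω = dirFunctional (X t ω).1 (X t ω).2 ((X t ω).2 - M.ψ (X t ω).1)
          (M.fastObs (s t ω, a t ω, s (t + 1) ω))
          - dirFunctional (X t ω).1 (X t ω).2 ((X t ω).2 - M.ψ (X t ω).1)
            (M.meanA, M.meanb, M.meanC) := map_sub _ _ _
      have h4 := mul_le_mul_of_nonneg_left h2 hbt0.le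
      rw [hηl] at h4
      simp only [trackErr]
      rw [h3]
      linarith
    have hint : ∫ ω, M.trackErr Rθ Rw (polyStep cα σ) (polyStep cβ ν) θ0 w0 s a (t + 1) ω ∂Pr
        ≤ (1 - 2 * η * bt)
          * ∫ ω, M.trackErr Rθ Rw (polyStep cα σ) (polyStep cβ ν) θ0 w0 s a t ω ∂Pr
          + 2 * bt * ∫ ω, N ω ∂Pr + Q := by
      have i1 := hu.const_mul (1 - 2 * η * bt)
      have i2 := hNint.const_mul (2 * bt)
      refine (integral_mono hu' ((i1.add i2).add (integrable_const Q)) hpt).trans (le_of_eq ?_)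
      rw [← integral_const_mul, ← integral_const_mul, ← integral_add i1 i2]
      exact (integral_add (i1.add i2) (integrable_const Q)).trans (by simp)
    have q1 : (1 + 2 * η * bt) * (bt * G) ^ 2
        ≤ (1 + 2 * η * cβ) * G ^ 2 * cβ * (bt * (t : ℝ) ^ (-δ)) := by
      calc (1 + 2 * η * bt) * (bt * G) ^ 2 = (1 + 2 * η * bt) * G ^ 2 * bt * bt := by ring
        _ ≤ (1 + 2 * η * cβ) * G ^ 2 * bt * (cβ * (t : ℝ) ^ (-δ)) := by gcongr
        _ = _ := by ring
    have q2 : (1 + 1 / (η * bt)) * (L * (at_ * G)) ^ 2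
        ≤ (cβ + 1 / η) * (L * G * r) ^ 2 * (bt * (t : ℝ) ^ (-δ)) := by
      calc (1 + 1 / (η * bt)) * (L * (at_ * G)) ^ 2
          = (1 + 1 / (η * bt)) * (L * G) ^ 2 * at_ ^ 2 := by ring
        _ ≤ (1 + 1 / (η * bt)) * (L * G) ^ 2 * (r ^ 2 * bt ^ 2 * (t : ℝ) ^ (-δ)) := by gcongr
        _ = (bt + 1 / η) * (L * G * r) ^ 2 * (bt * (t : ℝ) ^ (-δ)) := by field_simp
        _ ≤ _ := by gcongr
    have q3 : 2 * bt * (bt * I * Cn) ≤ 2 * I * Cn * cβ * (bt * (t : ℝ) ^ (-δ)) := by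
      calc 2 * bt * (bt * I * Cn) = 2 * I * Cn * bt * bt := by ring
        _ ≤ 2 * I * Cn * bt * (cβ * (t : ℝ) ^ (-δ)) := by gcongr
        _ = _ := by ring
    have q4 := mul_le_mul_of_nonneg_left hnoise (by positivity : 0 ≤ 2 * bt)
    have q5 : C * bt * (t : ℝ) ^ (-δ) = 2 * I * Cn * cβ * (bt * (t : ℝ) ^ (-δ))
        + (1 + 2 * η * cβ) * G ^ 2 * cβ * (bt * (t : ℝ) ^ (-δ))
        + (cβ + 1 / η) * (L * G * r) ^ 2 * (bt * (t : ℝ) ^ (-δ)) := by rw [hC]; ring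
    rw [q5]
    refine hint.trans ?_
    change _ + 2 * bt * (∫ ω, N ω ∂Pr) + Q ≤ _
    linarith

end OffPolicyProblem

/-! ### Rate of the training error -/

namespace OffPolicyProblem

variable {S A : Type*} [MeasurableSpace S] [MeasurableSpace A] {d : ℕ}
  [Finite A] [MeasurableSingletonClass A]
  {M : OffPolicyProblem S A d} {Rθ Rw : ℝ}

set_option maxHeartbeats 400000 in
/-- Mean-square rate of the training error. -/
theorem exists_integral_trainErr_le (hsolv : M.Solvable) (hfeat : M.BoundedFeatures)
    (herg : M.GeometricallyErgodic) (hRθ : ‖M.θstar‖ ≤ Rθ)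
    (hRw : 2 * ‖M.invC‖ * ‖M.meanA‖ * Rθ ≤ Rw) {lθ lw : ℝ} (hlθ : M.SlowRate lθ)
    (hlw : M.FastRate lw) {σ ν cα cβ δ : ℝ} (hα : 0 < cα) (hβ : 0 < cβ) (hν : 0 < ν) (hν1 : ν < 1)
    (hνσ : ν < σ) (hσ1 : σ ≤ 1) (hδ : 0 ≤ δ) (hδν : δ ≤ ν) (hδσ : δ ≤ 2 * (σ - ν))
    (hcrit : σ < 1 ∨ σ = 1 ∧ δ < -(5 / 6 * lθ) * cα) :
    ∃ K : ℝ, 0 ≤ K ∧ ∀ (Ω : Type*) [mΩ : MeasurableSpace Ω] (Pr : Measure Ω)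
      [IsProbabilityMeasure Pr] (ℱ : Filtration ℕ mΩ) (s : ℕ → Ω → S) (a : ℕ → Ω → A),
      M.IsSamplePath Pr ℱ s a → ∀ (θ0 w0 : Param d) (t : ℕ), 1 ≤ t →
        ∫ ω, M.trainErr Rθ Rw (polyStep cα σ) (polyStep cβ ν) θ0 w0 s a t ω ∂Pr
          ≤ K * (t : ℝ) ^ (-δ) := by
  obtain ⟨B, hB0, hB⟩ := exists_norm_le hfeat
  have h0 : 0 ≤ Rθ := (norm_nonneg _).trans hRθ
  have h0' : 0 ≤ Rw := le_trans (by positivity) hRw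
  obtain ⟨Kz, hKz0, hKz⟩ := exists_integral_trackErr_le hsolv hfeat herg hRθ hRw hlw hα hβ hν hν1
    hνσ hδ hδν hδσ
  obtain ⟨Cn, hCn0, hCn⟩ := exists_noise_bound herg (stronglyMeasurable_slowObs (M := M))
    (fun o => (norm_obs_le hB o).2)
  have hl : lθ < 0 := hlθ.1
  set G := B * (Rθ + 1 + Rw) with hG
  have hG0 : 0 ≤ G := by positivity
  set r := cα / cβ with hr
  have hr0 : 0 < r := by positivity
  -- The direction depends on `w`, which moves at the fast scale, so the noise costs `α * β` per
  -- step rather than `α ^ 2`.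
  set I := 2 * Rθ * (r * G + G) + r * G * (Rθ + 1 + Rw) with hI
  have hI0 : 0 ≤ I := by positivity
  set q := 6 * ‖M.meanB‖ ^ 2 / (-lθ) with hq
  have hq0 : 0 ≤ q := div_nonneg (by positivity) (by linarith)
  set U := (2 * Rθ) ^ 2 + 2 * (2 * Rθ * (Rθ + 1 + Rw) * Cn) with hU
  have hBYC : 0 ≤ 2 * Rθ * (Rθ + 1 + Rw) * Cn := by positivity
  set C := 2 * I * Cn * cβ + r * G ^ 2 * cβ + q * Kz with hC
  obtain ⟨K, hK0, hK⟩ := chung_telescoping (c := cα) (p := σ) (b := -(5 / 6 * lθ)) (δ := δ)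
    (C := C) (U := U) hα (hν.trans hνσ) hσ1 (by linarith) (by positivity) (by positivity) hδ
    (hδν.trans hνσ.le) hcrit
  refine ⟨K, hK0, ?_⟩
  intro Ω mΩ Pr _ ℱ s a h θ0 w0
  set X : ℕ → Ω → Param d × Param d := fun t ω =>
    M.tdc Rθ Rw (polyStep cα σ) (polyStep cβ ν) θ0 w0 (fun i => (s i ω, a i ω, s (i + 1) ω)) t
    with hX
  have hXm : ∀ t, StronglyMeasurable[ℱ t] (X t) := fun t => stronglyMeasurable_tdc h t
  have hem : ∀ t, StronglyMeasurable[ℱ t] fun ω => (X t ω).1 - M.θstar :=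
    fun t => stronglyMeasurable_training h t
  have hαs : ∀ t, 0 < polyStep cα σ t := polyStep_pos hα
  have hβs : ∀ t, 0 < polyStep cβ ν t := polyStep_pos hβ
  have hαβ : ∀ t, polyStep cα σ t ≤ r * polyStep cβ ν t :=
    polyStep_le_mul_polyStep hα hβ hνσ.le
  have heb : ∀ t, 1 ≤ t → ∀ ω, ‖(X t ω).1 - M.θstar‖ ≤ 2 * Rθ :=
    fun t ht ω => norm_training_le hRθ h0' ht _
  have hXb : ∀ t, 1 ≤ t → ∀ ω, ‖(X t ω).1‖ ≤ Rθ ∧ ‖(X t ω).2‖ ≤ Rw :=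
    fun t ht ω => norm_tdc_le h0 h0' ht
  have hYm : ∀ t, StronglyMeasurable[ℱ t] fun ω =>
      dirFunctional (X t ω).1 (X t ω).2 ((X t ω).1 - M.θstar) := by
    intro t
    have hX1 := continuous_fst.comp_stronglyMeasurable (hXm t)
    have hX2 := continuous_snd.comp_stronglyMeasurable (hXm t)
    exact stronglyMeasurable_dirFunctional hX1 hX2 (hem t)
  obtain ⟨D, hDb, hD⟩ := hCn Ω Pr ℱ s a h
    (fun t ω => dirFunctional (X t ω).1 (X t ω).2 ((X t ω).1 - M.θstar))
    (2 * Rθ * (Rθ + 1 + Rw)) hYm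
    (fun t ht ω => by
      obtain ⟨h1, h2⟩ := hXb t ht ω
      refine (norm_dirFunctional_le _ _ _).trans ?_
      have := heb t ht ω
      gcongr)
  refine hK (fun t => ∫ ω, M.trainErr Rθ Rw (polyStep cα σ) (polyStep cβ ν) θ0 w0 s a t ω ∂Pr)
    (fun t => 2 * D t) (fun t ht => ?_) (fun t ht => ?_) (fun t ht => ?_)
  · refine (Real.le_norm_self _).trans ((norm_integral_le_of_norm_le_const (C := (2 * Rθ) ^ 2)
      (ae_of_all _ fun ω => ?_)).trans ?_)
    · rw [trainErr, norm_pow, norm_norm]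
      gcongr
      exact heb t ht ω
    · simp only [probReal_univ, mul_one]
      linarith
  · rw [abs_mul, abs_two]
    nlinarith [hDb t ht, sq_nonneg (2 * Rθ)]
  · set at_ := polyStep cα σ t with hat
    set bt := polyStep cβ ν t with hbt
    have hat0 : 0 < at_ := hαs t
    have hbt0 : 0 < bt := hβs t
    have hab : at_ ≤ r * bt := hαβ t
    have hx0 : 0 ≤ (t : ℝ) ^ (-δ) := Real.rpow_nonneg (Nat.cast_nonneg t) _
    have hbx : bt ≤ cβ * (t : ℝ) ^ (-δ) := polyStep_le_mul_rpow hβ hδ hδν ht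
    have hnoise := hD t ht (bt * I) (fun ω => by
      have h1 : ‖(X (t + 1) ω).1 - (X t ω).1‖ ≤ at_ * G :=
        norm_tdc_succ_fst_sub_self_le hB hB0 h0 h0' ht hat0.le
      have h2 : ‖(X (t + 1) ω).2 - (X t ω).2‖ ≤ bt * G :=
        norm_tdc_succ_snd_sub_self_le hB hB0 h0 h0' ht hbt0.le
      have h4 : ‖(X (t + 1) ω).1 - M.θstar - ((X t ω).1 - M.θstar)‖ ≤ at_ * G := by
        rwa [sub_sub_sub_cancel_right]
      have h5 := heb (t + 1) (by omega) ω
      obtain ⟨h6, h7⟩ := hXb t ht ω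
      refine (norm_dirFunctional_sub_le _ _ _ _ _ _).trans ?_
      calc _ ≤ 2 * Rθ * (at_ * G + bt * G) + at_ * G * (Rθ + 1 + Rw) := by gcongr
        _ ≤ 2 * Rθ * (r * bt * G + bt * G) + r * bt * G * (Rθ + 1 + Rw) := by gcongr
        _ = bt * I := by rw [hI]; ring)
    rw [(integral_obs hfeat).2] at hnoise
    have hNint := integrable_dirFunctional (α := polyStep cα σ) (β := polyStep cβ ν) (θ0 := θ0)
      (w0 := w0) h hRθ h0' ht (hem t) (heb t ht)
      (stronglyMeasurable_slowObs (M := M)) (fun o => (norm_obs_le hB o).2)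
      (M.meanA, M.meanb, M.meanB)
    have hz := integrable_trackErr (α := polyStep cα σ) (β := polyStep cβ ν) (θ0 := θ0)
      (w0 := w0) h hsolv hRθ hRw h0' ht
    have he := integrable_trainErr (α := polyStep cα σ) (β := polyStep cβ ν) (θ0 := θ0)
      (w0 := w0) h hRθ h0' ht
    have he' := integrable_trainErr (α := polyStep cα σ) (β := polyStep cβ ν) (θ0 := θ0)
      (w0 := w0) h hRθ h0' (t := t + 1) (by omega)
    set N : Ω → ℝ := fun ω => dirFunctional (X t ω).1 (X t ω).2 ((X t ω).1 - M.θstar)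
      (M.slowObs (s t ω, a t ω, s (t + 1) ω) - (M.meanA, M.meanb, M.meanB)) with hN
    have hpt : ∀ ω, M.trainErr Rθ Rw (polyStep cα σ) (polyStep cβ ν) θ0 w0 s a (t + 1) ω
        ≤ (1 - -(5 / 6 * lθ) * at_)
            * M.trainErr Rθ Rw (polyStep cα σ) (polyStep cβ ν) θ0 w0 s a t ω
          + 2 * at_ * N ω
          + at_ * q * M.trackErr Rθ Rw (polyStep cα σ) (polyStep cβ ν) θ0 w0 s a t ω
          + (at_ * G) ^ 2 := by
      intro ω
      have h1 := sq_norm_training_succ_le (α := polyStep cα σ) (β := polyStep cβ ν) (θ0 := θ0)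
        (w0 := w0) (o := fun i => (s i ω, a i ω, s (i + 1) ω)) hRθ hB hB0 h0 h0' ht
        hat0.le (θ := (X t ω).1) (w := (X t ω).2) (θ' := (X (t + 1) ω).1)
        (w' := (X (t + 1) ω).2) rfl rfl
      have h2 := dirFunctional_slow_mean_le hsolv hfeat hlθ (X t ω).1 (X t ω).2
      rw [← hq] at h2
      have h3 : N ω = dirFunctional (X t ω).1 (X t ω).2 ((X t ω).1 - M.θstar)
          (M.slowObs (s t ω, a t ω, s (t + 1) ω))
          - dirFunctional (X t ω).1 (X t ω).2 ((X t ω).1 - M.θstar)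
            (M.meanA, M.meanb, M.meanB) := map_sub _ _ _
      have h4 := mul_le_mul_of_nonneg_left h2 hat0.le
      simp only [trainErr, trackErr]
      rw [h3]
      linarith
    have hint : ∫ ω, M.trainErr Rθ Rw (polyStep cα σ) (polyStep cβ ν) θ0 w0 s a (t + 1) ω ∂Pr
        ≤ (1 - -(5 / 6 * lθ) * at_)
          * ∫ ω, M.trainErr Rθ Rw (polyStep cα σ) (polyStep cβ ν) θ0 w0 s a t ω ∂Pr
          + 2 * at_ * ∫ ω, N ω ∂Pr
          + at_ * q * ∫ ω, M.trackErr Rθ Rw (polyStep cα σ) (polyStep cβ ν) θ0 w0 s a t ω ∂Pr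
          + (at_ * G) ^ 2 := by
      have i1 := he.const_mul (1 - -(5 / 6 * lθ) * at_)
      have i2 := hNint.const_mul (2 * at_)
      have i3 := hz.const_mul (at_ * q)
      refine (integral_mono he' (((i1.add i2).add i3).add (integrable_const ((at_ * G) ^ 2)))
        hpt).trans (le_of_eq ?_)
      rw [← integral_const_mul, ← integral_const_mul, ← integral_const_mul, ← integral_add i1 i2]
      refine (integral_add ((i1.add i2).add i3) (integrable_const _)).trans ?_
      simp only [integral_const, probReal_univ, one_smul]
      congr 1
      exact integral_add (i1.add i2) i3
    have q1 : (at_ * G) ^ 2 ≤ r * G ^ 2 * cβ * (at_ * (t : ℝ) ^ (-δ)) := by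
      calc (at_ * G) ^ 2 = at_ * G ^ 2 * at_ := by ring
        _ ≤ at_ * G ^ 2 * (r * (cβ * (t : ℝ) ^ (-δ))) := by
            gcongr
            exact hab.trans (by gcongr)
        _ = _ := by ring
    -- The coupling enters with one factor `α` and the tracking rate `t ^ (-δ)`, exactly the forcing
    -- that Chung's lemma permits for the exponent `δ`.
    have q2 := mul_le_mul_of_nonneg_left (hKz Ω Pr ℱ s a h θ0 w0 t ht)
      (mul_nonneg hat0.le hq0)
    have q3 : 2 * at_ * (bt * I * Cn) ≤ 2 * I * Cn * cβ * (at_ * (t : ℝ) ^ (-δ)) := by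
      calc 2 * at_ * (bt * I * Cn) = 2 * I * Cn * at_ * bt := by ring
        _ ≤ 2 * I * Cn * at_ * (cβ * (t : ℝ) ^ (-δ)) := by gcongr
        _ = _ := by ring
    have q4 := mul_le_mul_of_nonneg_left hnoise (by positivity : 0 ≤ 2 * at_)
    have q5 : C * at_ * (t : ℝ) ^ (-δ) = 2 * I * Cn * cβ * (at_ * (t : ℝ) ^ (-δ))
        + r * G ^ 2 * cβ * (at_ * (t : ℝ) ^ (-δ))
        + at_ * q * (Kz * (t : ℝ) ^ (-δ)) := by rw [hC]; ring
    rw [q5]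
    refine hint.trans ?_
    change _ + 2 * at_ * (∫ ω, N ω ∂Pr) + _ + _ ≤ _
    linarith

end OffPolicyProblem

/-! ### Comparison with the stated rates -/

section Rates

/-- The threshold `3 / 2 * ν < σ` is `ν < 2 * (σ - ν)`, so `rateExp` picks the smaller exponent,
reduced by `ε` in the second case. -/
theorem rpow_neg_min_le_hRate {σ ν ε : ℝ} (hε : 0 < ε) {t : ℕ} (ht : 1 ≤ t) :
    (t : ℝ) ^ (-min ν (2 * (σ - ν))) ≤ hRate σ ν ε t := by
  have h1 : (1 : ℝ) ≤ t := by exact_mod_cast ht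
  rw [hRate, one_div, ← Real.rpow_neg (by linarith)]
  refine Real.rpow_le_rpow_of_exponent_le h1 (neg_le_neg ?_)
  unfold rateExp
  split_ifs with h
  · exact le_min le_rfl (by linarith)
  · exact le_min (by linarith) (by linarith)

theorem hRate_mem_Ioc {σ ν ε : ℝ} (hν : 0 < ν) (hε : ε ∈ Ioc 0 (σ - ν)) {t : ℕ}
    (ht : 1 ≤ t) : hRate σ ν ε t ∈ Ioc (0 : ℝ) 1 := by
  have h1 : (1 : ℝ) ≤ t := by exact_mod_cast ht
  have h2 : 0 ≤ rateExp σ ν ε := by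
    unfold rateExp
    split_ifs
    · exact hν.le
    · linarith [hε.1, hε.2]
  exact ⟨by unfold hRate; positivity, div_le_one_of_le₀ (Real.one_le_rpow h1 h2) (by positivity)⟩

/-- Lowering the exponent to `1 - ε` only enlarges `h ≤ 1`. The constant is squared so that it
survives the power: `2 * (1 - ε) ≥ 1` because `ε ≤ 1 / 2`. -/
theorem mul_le_rpow_one_sub {K x h ε : ℝ} (hK : 1 ≤ K) (hx : 0 ≤ x) (hh : h ∈ Ioc (0 : ℝ) 1)
    (hε : ε ∈ Ioc (0 : ℝ) (1 / 2)) : K * h ≤ (K ^ 2 * (x + h)) ^ (1 - ε) := by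
  have hε2 := hε.2
  have h1 : K ≤ (K ^ 2) ^ (1 - ε) := by
    rw [← Real.rpow_natCast, ← Real.rpow_mul (by linarith)]
    exact Real.self_le_rpow_of_one_le hK (by push_cast; linarith)
  have h2 : h ≤ h ^ (1 - ε) := Real.self_le_rpow_of_le_one hh.1.le hh.2 (by linarith [hε.1])
  calc K * h ≤ (K ^ 2) ^ (1 - ε) * h ^ (1 - ε) := mul_le_mul h1 h2 hh.1.le (by positivity)
    _ = (K ^ 2 * h) ^ (1 - ε) := (Real.mul_rpow (by positivity) hh.1.le).symm
    _ ≤ _ := by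
      have := hh.1
      refine Real.rpow_le_rpow (by positivity) ?_ (by linarith)
      gcongr
      linarith

/-- The weighted mean `(2 / 3) * ν + (1 / 3) * (2 * (σ - ν))` equals `2 * σ / 3 ≤ 2 / 3`, so the
smaller exponent is at most `2 / 3`. Equality forces both exponents to agree and `σ = 1`. -/
theorem rateExp_zero_le {σ ν : ℝ} (hσ : σ ≤ 1) :
    rateExp σ ν 0 ≤ 2 / 3 ∧ (rateExp σ ν 0 = 2 / 3 ↔ σ = 1 ∧ 3 / 2 * ν = 1) := by
  unfold rateExp
  split_ifs with h
  · refine ⟨by linarith, fun h' => ?_, fun h' => ?_⟩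
    · linarith
    · linarith [h'.1, h'.2]
  · push Not at h
    refine ⟨by linarith, fun h' => ⟨?_, ?_⟩, fun h' => ?_⟩
    · linarith
    · linarith
    · linarith [h'.1, h'.2]

end Rates

end

theorem theorem1 {S A : Type*} [MeasurableSpace S] [MeasurableSpace A] [Finite A]
    [MeasurableSingletonClass A] {d : ℕ} (M : OffPolicyProblem S A d)
    (hsolv : M.Solvable) (hfeat : M.BoundedFeatures) (herg : M.GeometricallyErgodic)
    (Rθ Rw lθ lw : ℝ) (hRθ : ‖M.θstar‖ ≤ Rθ) (hRw : 2 * ‖M.invC‖ * ‖M.meanA‖ * Rθ ≤ Rw)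
    (hlθ : M.SlowRate lθ) (hlw : M.FastRate lw) :
    -- diminishing stepsizes with `0 < ν < σ < 1`
    (∀ σ ν cα cβ ε ε' : ℝ, 0 < ν → ν < σ → σ < 1 → 0 < cα → cα < 1 / |lθ| →
      0 < cβ → cβ < 1 / |lw| → ε ∈ Ioc 0 (σ - ν) → ε' ∈ Ioc (0 : ℝ) (1 / 2) →
      ∃ K : ℝ, 0 < K ∧ ∀ (Ω : Type*) [mΩ : MeasurableSpace Ω] (Pr : Measure Ω)
        [IsProbabilityMeasure Pr] (ℱ : Filtration ℕ mΩ) (s : ℕ → Ω → S) (a : ℕ → Ω → A),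
        M.IsSamplePath Pr ℱ s a → ∀ (θ0 w0 : Param d) (t : ℕ), 1 ≤ t →
          (Integrable (M.trainErr Rθ Rw (polyStep cα σ) (polyStep cβ ν) θ0 w0 s a t) Pr ∧
            ∫ ω, M.trainErr Rθ Rw (polyStep cα σ) (polyStep cβ ν) θ0 w0 s a t ω ∂Pr ≤
              K * Real.exp (-|lθ| * cα / (1 - σ) * ((t : ℝ) ^ (1 - σ) - 1))
                + K * (Real.log t / (t : ℝ) ^ σ)
                + (K * (Real.log t / (t : ℝ) ^ ν + hRate σ ν ε t)) ^ (1 - ε')) ∧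
          (Integrable (M.trackErr Rθ Rw (polyStep cα σ) (polyStep cβ ν) θ0 w0 s a t) Pr ∧
            ∫ ω, M.trackErr Rθ Rw (polyStep cα σ) (polyStep cβ ν) θ0 w0 s a t ω ∂Pr ≤
              K * (Real.log t / (t : ℝ) ^ ν) + K * hRate σ ν ε t)) ∧
    -- the case `σ = 1`, `cα = 1 / |lθ|`
    (∀ ν cβ ε ε' : ℝ, 0 < ν → ν < 1 → 0 < cβ → cβ < 1 / |lw| →
      ε ∈ Ioc 0 (1 - ν) → ε' ∈ Ioc (0 : ℝ) (1 / 2) →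
      ∃ K : ℝ, 0 < K ∧ ∀ (Ω : Type*) [mΩ : MeasurableSpace Ω] (Pr : Measure Ω)
        [IsProbabilityMeasure Pr] (ℱ : Filtration ℕ mΩ) (s : ℕ → Ω → S) (a : ℕ → Ω → A),
        M.IsSamplePath Pr ℱ s a → ∀ (θ0 w0 : Param d) (t : ℕ), 1 ≤ t →
          Integrable (M.trainErr Rθ Rw (polyStep (1 / |lθ|) 1) (polyStep cβ ν) θ0 w0 s a t) Pr ∧
            ∫ ω, M.trainErr Rθ Rw (polyStep (1 / |lθ|) 1) (polyStep cβ ν) θ0 w0 s a t ω ∂Pr ≤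
              K * (Real.log t ^ 2 / t)
                + (K * (Real.log t / (t : ℝ) ^ ν + hRate 1 ν ε t)) ^ (1 - ε')) ∧
    -- the rate at `σ = 1.5 ν = 1`
    (∀ cβ : ℝ, 0 < cβ → cβ < 1 / |lw| →
      ∃ K : ℝ, 0 < K ∧ ∀ (Ω : Type*) [mΩ : MeasurableSpace Ω] (Pr : Measure Ω)
        [IsProbabilityMeasure Pr] (ℱ : Filtration ℕ mΩ) (s : ℕ → Ω → S) (a : ℕ → Ω → A),
        M.IsSamplePath Pr ℱ s a → ∀ (θ0 w0 : Param d) (t : ℕ), 2 ≤ t →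
          Integrable (M.trainErr Rθ Rw (polyStep (1 / |lθ|) 1) (polyStep cβ (2 / 3))
            θ0 w0 s a t) Pr ∧
            ∫ ω, M.trainErr Rθ Rw (polyStep (1 / |lθ|) 1) (polyStep cβ (2 / 3))
                θ0 w0 s a t ω ∂Pr ≤
              K * (Real.log t / (t : ℝ) ^ (2 / 3 : ℝ))) ∧
    -- the limiting decay exponent is largest exactly at `σ = 1.5 ν = 1`
    (∀ σ ν : ℝ, 0 < ν → ν < σ → σ ≤ 1 →
      rateExp σ ν 0 ≤ 2 / 3 ∧ (rateExp σ ν 0 = 2 / 3 ↔ σ = 1 ∧ 3 / 2 * ν = 1)) := by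
  have h0' : 0 ≤ Rw := le_trans (mul_nonneg (by positivity) ((norm_nonneg _).trans hRθ)) hRw
  have hl : lθ < 0 := hlθ.1
  have hl0 : lθ ≠ 0 := hl.ne
  refine ⟨?_, ?_, ?_, fun σ ν _ _ hσ => rateExp_zero_le hσ⟩
  · intro σ ν cα cβ ε ε' hν hνσ hσ hα _ hβ _ hε hε'
    have hδ : 0 ≤ min ν (2 * (σ - ν)) := le_min hν.le (by linarith)
    obtain ⟨K₁, hK₁, h₁⟩ := OffPolicyProblem.exists_integral_trainErr_le hsolv hfeat herg hRθ hRw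
      hlθ hlw hα hβ hν (hνσ.trans hσ) hνσ hσ.le hδ (min_le_left _ _) (min_le_right _ _) (Or.inl hσ)
    obtain ⟨K₂, hK₂, h₂⟩ := OffPolicyProblem.exists_integral_trackErr_le hsolv hfeat herg hRθ hRw
      hlw hα hβ hν (hνσ.trans hσ) hνσ hδ (min_le_left _ _) (min_le_right _ _)
    refine ⟨(K₁ + K₂ + 1) ^ 2, by positivity, ?_⟩
    intro Ω mΩ Pr _ ℱ s a h θ0 w0 t ht
    have h1 : (1 : ℝ) ≤ t := by exact_mod_cast ht
    have hlog := Real.log_nonneg h1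
    have hh := hRate_mem_Ioc hν hε ht
    have hle := rpow_neg_min_le_hRate (σ := σ) (ν := ν) hε.1 ht
    have hh0 := hh.1.le
    refine ⟨⟨OffPolicyProblem.integrable_trainErr h hRθ h0' ht, ?_⟩,
      OffPolicyProblem.integrable_trackErr h hsolv hRθ hRw h0' ht, ?_⟩
    · refine (h₁ Ω Pr ℱ s a h θ0 w0 t ht).trans ?_
      have key := mul_le_rpow_one_sub (K := K₁ + K₂ + 1) (by linarith)
        (by positivity : 0 ≤ Real.log t / (t : ℝ) ^ ν) hh hε'
      have : K₁ * (t : ℝ) ^ (-min ν (2 * (σ - ν))) ≤ (K₁ + K₂ + 1) * hRate σ ν ε t := by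
        gcongr; linarith
      -- The last term of the bound already dominates; the exponential and logarithmic terms are
      -- merely nonnegative.
      refine (this.trans key).trans (le_add_of_nonneg_left ?_)
      positivity
    · refine (h₂ Ω Pr ℱ s a h θ0 w0 t ht).trans ?_
      have : K₂ * (t : ℝ) ^ (-min ν (2 * (σ - ν))) ≤ (K₁ + K₂ + 1) ^ 2 * hRate σ ν ε t := by
        gcongr; nlinarith
      exact this.trans (le_add_of_nonneg_left (by positivity))
  · intro ν cβ ε ε' hν hν1 hβ _ hε hε'
    have hδ : 0 ≤ min ν (2 * (1 - ν)) := le_min hν.le (by linarith)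
    -- Chung's lemma at `p = 1` needs the exponent below the contraction constant `5 / 6`; the
    -- minimum is at most `2 / 3`, its value at `ν = 2 / 3`.
    have hcrit : min ν (2 * (1 - ν)) < -(5 / 6 * lθ) * (1 / |lθ|) := by
      rw [abs_of_neg hl, show -(5 / 6 * lθ) * (1 / -lθ) = 5 / 6 by field_simp]
      rcases le_total ν (2 / 3) with h | h
      · exact (min_le_left _ _).trans_lt (by linarith)
      · exact (min_le_right _ _).trans_lt (by linarith)
    obtain ⟨K₁, hK₁, h₁⟩ := OffPolicyProblem.exists_integral_trainErr_le hsolv hfeat herg hRθ hRw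
      hlθ hlw (by have := abs_pos.2 hl.ne; positivity : 0 < 1 / |lθ|) hβ hν hν1 hν1 le_rfl hδ
      (min_le_left _ _) (min_le_right _ _) (Or.inr ⟨rfl, hcrit⟩)
    refine ⟨(K₁ + 1) ^ 2, by positivity, ?_⟩
    intro Ω mΩ Pr _ ℱ s a h θ0 w0 t ht
    have h1 : (1 : ℝ) ≤ t := by exact_mod_cast ht
    have hlog := Real.log_nonneg h1
    have hh := hRate_mem_Ioc hν hε ht
    have hle := rpow_neg_min_le_hRate (σ := 1) (ν := ν) hε.1 ht
    have hh0 := hh.1.le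
    refine ⟨OffPolicyProblem.integrable_trainErr h hRθ h0' ht,
      (h₁ Ω Pr ℱ s a h θ0 w0 t ht).trans ?_⟩
    have key := mul_le_rpow_one_sub (K := K₁ + 1) (by linarith)
      (by positivity : 0 ≤ Real.log t / (t : ℝ) ^ ν) hh hε'
    have : K₁ * (t : ℝ) ^ (-min ν (2 * (1 - ν))) ≤ (K₁ + 1) * hRate 1 ν ε t := by
      gcongr; linarith
    exact (this.trans key).trans (le_add_of_nonneg_left (by positivity))
  · intro cβ hβ _
    obtain ⟨K₁, hK₁, h₁⟩ := OffPolicyProblem.exists_integral_trainErr_le hsolv hfeat herg hRθ hRw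
      hlθ hlw (σ := 1) (ν := 2 / 3) (δ := 2 / 3)
      (by have := abs_pos.2 hl.ne; positivity : 0 < 1 / |lθ|) hβ
      (by norm_num) (by norm_num) (by norm_num) le_rfl (by norm_num) le_rfl (by norm_num)
      (Or.inr ⟨rfl, by
        rw [abs_of_neg hl, show -(5 / 6 * lθ) * (1 / -lθ) = 5 / 6 by field_simp]; norm_num⟩)
    have hlog2 : 0 < Real.log 2 := Real.log_pos one_lt_two
    -- The rate holds without the logarithm; dividing by `log 2 ≤ log t` inserts it, hence `2 ≤ t`.
    refine ⟨(K₁ + 1) / Real.log 2, by positivity, ?_⟩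
    intro Ω mΩ Pr _ ℱ s a h θ0 w0 t ht
    have ht2 : (2 : ℝ) ≤ t := by exact_mod_cast ht
    refine ⟨OffPolicyProblem.integrable_trainErr h hRθ h0' (by omega),
      (h₁ Ω Pr ℱ s a h θ0 w0 t (by omega)).trans ?_⟩
    have hlogt : Real.log 2 ≤ Real.log t := Real.log_le_log two_pos ht2
    rw [Real.rpow_neg (by linarith), ← div_eq_mul_inv, ← mul_div_assoc]
    gcongr
    rw [div_mul_eq_mul_div, le_div_iff₀ hlog2]
    gcongr
    linarith
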